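/- Let $N\ge 1$, let $\Omega\subset\mathbb{R}^N$ be a bounded open set, let $T>0$ and $Q=(0,T)\times\Omega$. Let $u_0\in L^1_{loc}(\Omega)$ be nonnegative and, for $n\in\mathbb{N}$, let $T_n(r)=\max(\min(n,r),-n)$. For every $n$ let $u_n$ be a weak solution of the heat equation $$\begin{cases}(u_n)_t-\Delta u_n=0&\text{in }Q,\\ u_n=T_n(u_0)&\text{on }\{0\}\times\Omega,\\ u_n=n&\text{on }(0,T)\times\partial\Omega,\end{cases}$$ that is, $u_n-n\in L^2(0,T;W^{1,2}_0(\Omega))$, where $W^{1,2}_0(\Omega)$ is the closure of $C_c^\infty(\Omega)$ in $W^{1,2}(\Omega)$, and $$\int_Q\bigl(-u_n\,\varphi_t+\nabla u_n\cdot\nabla\varphi\bigr)\,dx\,dt=\int_\Omega T_n(u_0)\,\varphi(0,\cdot)\,dx\qquad\text{for all }\varphi\in C_c^\infty([0,T)\times\Omega).$$ Then each $u_n$ coincides almost everywhere in $Q$ with a (necessarily unique) continuous function on $Q$, and, denoting this function again by $u_n$, one has $u_n(t,x)\to+\infty$ as $n\to\infty$ for every $(t,x)\in Q$. -/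

import Mathlib

open MeasureTheory Set Filter Topology
open scoped ContDiff ENNReal

noncomputable section

namespace HeatLarge

/-- Euclidean space `ℝ^N`. -/
abbrev Space (N : ℕ) : Type := EuclideanSpace ℝ (Fin N)

/-- The cylinder `Q = (0,T) × Ω`; its points are pairs `(t, x)`. -/
def cylinder {N : ℕ} (T : ℝ) (Ω : Set (Space N)) : Set (ℝ × Space N) :=
  Ioo 0 T ×ˢ Ω

/-- The truncation `T_k(r) = max (min k r) (-k)`. -/
def trunc (k r : ℝ) : ℝ := max (min k r) (-k)

/-- `φ ∈ C_c^∞(U)`, for functions extended by zero outside `U`. -/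
def IsTest {E : Type*} [NormedAddCommGroup E] [NormedSpace ℝ E] (U : Set E) (φ : E → ℝ) : Prop :=
  ContDiff ℝ ∞ φ ∧ HasCompactSupport φ ∧ tsupport φ ⊆ U

/-- `w` belongs to `W_0^{1,2}(Ω)`, the closure of `C_c^∞(Ω)` in `W^{1,2}(Ω)`, and `g` is its weak
gradient: `(w, g)` is the limit in `L²(Ω) × L²(Ω; ℝ^N)` of pairs `(φ, ∇φ)` with `φ ∈ C_c^∞(Ω)`. -/
def MemW0 {N : ℕ} (Ω : Set (Space N)) (w : Space N → ℝ) (g : Space N → Space N) : Prop :=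
  MemLp w 2 (volume.restrict Ω) ∧ MemLp g 2 (volume.restrict Ω) ∧
  ∃ φ : ℕ → Space N → ℝ, (∀ k, IsTest Ω (φ k)) ∧
    Tendsto (fun k => eLpNorm (fun x => φ k x - w x) 2 (volume.restrict Ω)) atTop (𝓝 0) ∧
    Tendsto (fun k => eLpNorm (fun x => gradient (φ k) x - g x) 2 (volume.restrict Ω))
      atTop (𝓝 0)

/-- `u` is a weak solution of `u_t - Δu = 0` in `Q = (0,T) × Ω` with `u = f` on `{0} × Ω` and
`u = b` (a constant) on `(0,T) × ∂Ω`: one has `u - b ∈ L²(0,T; W_0^{1,2}(Ω))`, and, with `G` the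
spatial weak gradient of `u`,
`∫_Q (-u φ_t + G · ∇φ) dx dt = ∫_Ω f φ(0,·) dx` for all `φ ∈ C_c^∞([0,T) × Ω)`
(these are the restrictions to `t ≥ 0` of the functions in `C_c^∞((-∞,T) × Ω)`). -/
def IsWeakSolution {N : ℕ} (T : ℝ) (Ω : Set (Space N)) (b : ℝ) (f : Space N → ℝ)
    (u : ℝ × Space N → ℝ) : Prop :=
  MemLp u 2 (volume.restrict (cylinder T Ω)) ∧
  ∃ G : ℝ × Space N → Space N,
    MemLp G 2 (volume.restrict (cylinder T Ω)) ∧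
    (∀ᵐ t ∂(volume.restrict (Ioo 0 T)),
      MemW0 Ω (fun x => u (t, x) - b) (fun x => G (t, x))) ∧
    ∀ φ : ℝ × Space N → ℝ, IsTest (Iio T ×ˢ Ω) φ →
      ∫ z in cylinder T Ω,
        (-(u z * deriv (fun s => φ (s, z.2)) z.1) +
          inner ℝ (G z) (gradient (fun y => φ (z.1, y)) z.2)) =
      ∫ x in Ω, f x * φ (0, x)

end HeatLarge

end

/-! The mechanism is comparison with `n` times one fixed subsolution. For a coordinate `i₀`, a bound
`A` of `x i₀` on `Ω` and `κ ≥ 0`, the function `exp (κ x_{i₀} + κ² t) - exp (κ A)` solves the heat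
equation and is nonpositive on `Ω` at time `0`. Normalised to be at most `1` for `t ≤ T`, it is the
`barrier`. Then `n * barrier` lies below `u_n` on the parabolic boundary, because `T_n(u₀) ≥ 0`
initially and the lateral value is `n`. Hence `n * barrier ≤ u_n` in `Q`. At a given point with `t >
0` the barrier is positive once `κ t > A - x_{i₀}`, so `u_n → ∞` there, at least linearly in `n`.
The choice of `κ` depends on the point but not on `n`.

Two facts about weak solutions have to be supplied.

Comparison: `u` has no time derivative in `L²`, so `b - u` is averaged over the past with a kernel
`ρ` supported in `(0, ε)`. The average `p` is differentiable in time, stays in `W_0^{1,2}`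
(`memW0_timeAvg`), vanishes at time `0`, and satisfies `∂ₜp - Δp ≤ b ρ(t)` weakly
(`weak_timeAvg_le`). It is compared with the smooth solution `S = b (∫₀ᵗ ρ - barrier(t - ε))` of
`∂ₜS - ΔS = b ρ(t)`, which is nonnegative, by testing with a smoothed positive part of `p - S`
(`ae_le_of_weak_subsolution`). Once `t ≥ ε` this bounds averages of `u` from below by `b * barrier(t
- ε)`. Letting `ε → 0` uses the continuity of the representative (`IsWeakSolution.mul_barrier_le`).

Continuity: this is Weyl's lemma for the heat operator. Testing with a cut-off heat kernel centred
at `z` splits the result into a `peak`, which tends to a Dirac mass, and a `remainder`, which is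
continuous with compact support because it only sees derivatives of the cutoffs. In the limit `u`
equals, locally and almost everywhere, the continuous function `z ↦ -∫ u(w) remainder(z - w) dw`
(`IsWeakSolution.setIntegral_mul_eq`). The local versions are then glued. -/

noncomputable section

namespace HeatLarge

variable {N : ℕ}

/-! ### Pairings in `L²` -/

section Pairing

variable {α : Type*} {mα : MeasurableSpace α} {μ : Measure α}
  {E : Type*} [NormedAddCommGroup E] [InnerProductSpace ℝ E]

theorem integrable_inner_of_memLp {f g : α → E} (hf : MemLp f 2 μ) (hg : MemLp g 2 μ) :
    Integrable (fun x => inner ℝ (f x) (g x)) μ := by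
  refine (hf.norm.integrable_mul hg.norm).mono
    (hf.aestronglyMeasurable.inner hg.aestronglyMeasurable) (Eventually.of_forall fun x => ?_)
  simpa using norm_inner_le_norm (𝕜 := ℝ) (f x) (g x)

theorem inner_toLp_toLp {f g : α → E} (hf : MemLp f 2 μ) (hg : MemLp g 2 μ) :
    inner ℝ (hf.toLp f) (hg.toLp g) = ∫ x, inner ℝ (f x) (g x) ∂μ := by
  rw [L2.inner_def]
  refine integral_congr_ae ?_
  filter_upwards [hf.coeFn_toLp, hg.coeFn_toLp] with x h1 h2
  rw [h1, h2]

theorem inner_toLp_left {f : α → E} (hf : MemLp f 2 μ) (g : Lp E 2 μ) :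
    inner ℝ (hf.toLp f) g = ∫ x, inner ℝ (f x) (g x) ∂μ := by
  rw [← inner_toLp_toLp hf (Lp.memLp g), Lp.toLp_coeFn]

theorem tendsto_integral_inner {f h : ℕ → α → E} {f' h' : α → E}
    (hf : ∀ k, MemLp (f k) 2 μ) (hf' : MemLp f' 2 μ) (hh : ∀ k, MemLp (h k) 2 μ)
    (hh' : MemLp h' 2 μ)
    (hfl : Tendsto (fun k => eLpNorm (fun x => f k x - f' x) 2 μ) atTop (𝓝 0))
    (hhl : Tendsto (fun k => eLpNorm (fun x => h k x - h' x) 2 μ) atTop (𝓝 0)) :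
    Tendsto (fun k => ∫ x, inner ℝ (f k x) (h k x) ∂μ) atTop
      (𝓝 (∫ x, inner ℝ (f' x) (h' x) ∂μ)) := by
  have h1 := (Lp.tendsto_Lp_iff_tendsto_eLpNorm'' f hf f' hf').2 hfl
  have h2 := (Lp.tendsto_Lp_iff_tendsto_eLpNorm'' h hh h' hh').2 hhl
  have := h1.inner (𝕜 := ℝ) h2
  simpa only [inner_toLp_toLp] using this

theorem tendsto_integral_mul {f h : ℕ → α → ℝ} {f' h' : α → ℝ}
    (hf : ∀ k, MemLp (f k) 2 μ) (hf' : MemLp f' 2 μ) (hh : ∀ k, MemLp (h k) 2 μ)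
    (hh' : MemLp h' 2 μ)
    (hfl : Tendsto (fun k => eLpNorm (fun x => f k x - f' x) 2 μ) atTop (𝓝 0))
    (hhl : Tendsto (fun k => eLpNorm (fun x => h k x - h' x) 2 μ) atTop (𝓝 0)) :
    Tendsto (fun k => ∫ x, f k x * h k x ∂μ) atTop (𝓝 (∫ x, f' x * h' x ∂μ)) := by
  have := tendsto_integral_inner (E := ℝ) hf hf' hh hh' hfl hhl
  simpa [mul_comm] using this

end Pairing

theorem memLp_two_of_continuous {F : Type*} [NormedAddCommGroup F] {Ω : Set (Space N)}
    (hΩ : Bornology.IsBounded Ω) {f : Space N → F} (hf : Continuous f) :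
    MemLp f 2 (volume.restrict Ω) := by
  have hK : IsCompact (closure Ω) := hΩ.isCompact_closure
  have : MemLp f 2 (volume.restrict (closure Ω)) := by
    have : IsFiniteMeasure ((volume : Measure (Space N)).restrict (closure Ω)) :=
      ⟨by simpa using hK.measure_lt_top⟩
    obtain ⟨C, hC⟩ := hK.exists_bound_of_continuousOn hf.continuousOn
    refine MemLp.of_bound (hf.aestronglyMeasurable) C ?_
    exact (ae_restrict_iff' isClosed_closure.measurableSet).2 (Eventually.of_forall hC)
  exact this.mono_measure (Measure.restrict_mono subset_closure le_rfl)

/-! ### Gradient and Laplacian -/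

/-- The vectors of the standard basis. -/
def stdVec (i : Fin N) : Space N := EuclideanSpace.basisFun (Fin N) ℝ i

/-- The Laplacian `∑ i, ∂ᵢ∂ᵢ f`. -/
def lap (f : Space N → ℝ) (x : Space N) : ℝ :=
  ∑ i, fderiv ℝ (fun y => fderiv ℝ f y (stdVec i)) x (stdVec i)

theorem inner_gradient_left (f : Space N → ℝ) (x v : Space N) :
    inner ℝ (gradient f x) v = fderiv ℝ f x v := by
  simp [gradient]

theorem inner_gradient_gradient (f g : Space N → ℝ) (x : Space N) :
    inner ℝ (gradient f x) (gradient g x) =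
      ∑ i, fderiv ℝ f x (stdVec i) * fderiv ℝ g x (stdVec i) := by
  rw [← (EuclideanSpace.basisFun (Fin N) ℝ).sum_inner_mul_inner]
  refine Finset.sum_congr rfl fun i _ => ?_
  rw [inner_gradient_left, real_inner_comm, inner_gradient_left, stdVec]

theorem continuous_gradient {f : Space N → ℝ} (hf : ContDiff ℝ 1 f) : Continuous (gradient f) :=
  (InnerProductSpace.toDual ℝ (Space N)).symm.continuous.comp (hf.continuous_fderiv one_ne_zero)

theorem hasCompactSupport_gradient {f : Space N → ℝ} (hf : HasCompactSupport f) :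
    HasCompactSupport (gradient f) := by
  refine (hf.fderiv (𝕜 := ℝ)).comp_left
    (g := (InnerProductSpace.toDual ℝ (Space N)).symm) (map_zero _)

theorem contDiff_fderiv_apply {E : Type*} [NormedAddCommGroup E] [NormedSpace ℝ E] {f : E → ℝ}
    {m n : WithTop ℕ∞} (hf : ContDiff ℝ n f) (h : m + 1 ≤ n) (v : E) :
    ContDiff ℝ m (fun y => fderiv ℝ f y v) :=
  (hf.fderiv_right h).clm_apply contDiff_const

theorem continuous_lap {f : Space N → ℝ} (hf : ContDiff ℝ 2 f) : Continuous (lap f) := by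
  refine continuous_finsetSum _ fun i _ => ?_
  exact (contDiff_fderiv_apply (m := 0)
    (contDiff_fderiv_apply (m := 1) hf (by norm_num) (stdVec i)) (by norm_num) _).continuous

theorem lap_eq_zero_of_notMem_tsupport {f : Space N → ℝ} {x : Space N} (hx : x ∉ tsupport f) :
    lap f x = 0 := by
  refine Finset.sum_eq_zero fun i _ => ?_
  have h0 : f =ᶠ[𝓝 x] fun _ => (0 : ℝ) := notMem_tsupport_iff_eventuallyEq.1 hx
  have h1 : (fun y => fderiv ℝ f y (stdVec i)) =ᶠ[𝓝 x] fun _ => (0 : ℝ) := by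
    filter_upwards [h0.fderiv (𝕜 := ℝ)] with y hy
    simp [hy]
  rw [h1.fderiv_eq]
  simp

theorem hasCompactSupport_lap {f : Space N → ℝ} (hf : HasCompactSupport f) :
    HasCompactSupport (lap f) :=
  HasCompactSupport.intro hf.isCompact fun _ hx => lap_eq_zero_of_notMem_tsupport hx

/-- Green's identity on the whole space. -/
theorem integral_inner_gradient_gradient {f g : Space N → ℝ} (hf : ContDiff ℝ 1 f)
    (hg : ContDiff ℝ 2 g) (hc : HasCompactSupport f ∨ HasCompactSupport g) :
    ∫ x, inner ℝ (gradient f x) (gradient g x) = -∫ x, f x * lap g x := by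
  have hg' : ∀ i : Fin N, ContDiff ℝ 1 (fun y => fderiv ℝ g y (stdVec i)) := fun i =>
    contDiff_fderiv_apply hg (by norm_num) _
  have hf' : ∀ i : Fin N, ContDiff ℝ 0 (fun y => fderiv ℝ f y (stdVec i)) := fun i =>
    contDiff_fderiv_apply hf (by norm_num) _
  have hg'' : ∀ i : Fin N, Continuous
      (fun x => fderiv ℝ (fun y => fderiv ℝ g y (stdVec i)) x (stdVec i)) := fun i =>
    (contDiff_fderiv_apply (m := 0) (hg' i) (by norm_num) _).continuous
  have sg : HasCompactSupport g → ∀ i : Fin N,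
      HasCompactSupport (fun y => fderiv ℝ g y (stdVec i)) := fun h i => h.fderiv_apply ℝ _
  have i1 : ∀ i : Fin N, Integrable
      (fun x => fderiv ℝ f x (stdVec i) * fderiv ℝ g x (stdVec i)) := fun i => by
    refine ((hf' i).continuous.mul (hg' i).continuous).integrable_of_hasCompactSupport ?_
    rcases hc with h | h
    · exact (h.fderiv_apply ℝ _).mul_right
    · exact (sg h i).mul_left
  have i2 : ∀ i : Fin N, Integrable (fun x => f x *
      fderiv ℝ (fun y => fderiv ℝ g y (stdVec i)) x (stdVec i)) := fun i => by
    refine (hf.continuous.mul (hg'' i)).integrable_of_hasCompactSupport ?_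
    rcases hc with h | h
    · exact h.mul_right
    · exact ((sg h i).fderiv_apply ℝ _).mul_left
  have i3 : ∀ i : Fin N, Integrable (fun x => f x * fderiv ℝ g x (stdVec i)) := fun i => by
    refine (hf.continuous.mul (hg' i).continuous).integrable_of_hasCompactSupport ?_
    rcases hc with h | h
    · exact h.mul_right
    · exact (sg h i).mul_left
  simp only [inner_gradient_gradient, lap, Finset.mul_sum]
  rw [integral_finsetSum _ fun i _ => i1 i, integral_finsetSum _ fun i _ => i2 i,
    ← Finset.sum_neg_distrib]
  refine Finset.sum_congr rfl fun i _ => ?_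
  rw [integral_mul_fderiv_eq_neg_fderiv_mul_of_integrable (i1 i) (i2 i) (i3 i)
    (fun x _ => hf.differentiable one_ne_zero x)
    (fun x _ => (hg' i).differentiable one_ne_zero x), neg_neg]

/-- Green's identity against the constant `1`, which is why that identity asks for compact support
of only one factor. It later makes the lateral constant `b` disappear from the distributional
equation. -/
theorem integral_lap_eq_zero {g : Space N → ℝ} (hg : ContDiff ℝ 2 g) (hc : HasCompactSupport g) :
    ∫ x, lap g x = 0 := by
  have := integral_inner_gradient_gradient (f := fun _ => (1 : ℝ)) contDiff_const hg (Or.inr hc)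
  have h0 : ∀ x : Space N, gradient (fun _ : Space N => (1 : ℝ)) x = 0 := fun x => by
    simp [gradient]
  simpa [h0] using this.symm

/-! ### Test functions and `W_0^{1,2}` -/

theorem IsTest.memLp {Ω : Set (Space N)} {φ : Space N → ℝ} (h : IsTest Ω φ) {μ : Measure (Space N)}
    [IsFiniteMeasureOnCompacts μ] : MemLp φ 2 μ :=
  h.1.continuous.memLp_of_hasCompactSupport h.2.1

theorem IsTest.contDiff {Ω : Set (Space N)} {φ : Space N → ℝ} (h : IsTest Ω φ) (n : ℕ) :
    ContDiff ℝ n φ := h.1.of_le (by exact_mod_cast le_top)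

theorem IsTest.continuous_gradient {Ω : Set (Space N)} {φ : Space N → ℝ} (h : IsTest Ω φ) :
    Continuous (gradient φ) := HeatLarge.continuous_gradient (h.contDiff 1)

theorem IsTest.memLp_gradient {Ω : Set (Space N)} {φ : Space N → ℝ} (h : IsTest Ω φ)
    {μ : Measure (Space N)} [IsFiniteMeasureOnCompacts μ] : MemLp (gradient φ) 2 μ :=
  h.continuous_gradient.memLp_of_hasCompactSupport (hasCompactSupport_gradient h.2.1)

theorem IsTest.eq_zero {Ω : Set (Space N)} {φ : Space N → ℝ} (h : IsTest Ω φ) {x : Space N}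
    (hx : x ∉ Ω) : φ x = 0 := image_eq_zero_of_notMem_tsupport fun h' => hx (h.2.2 h')

theorem IsTest.gradient_eq_zero {Ω : Set (Space N)} {φ : Space N → ℝ} (h : IsTest Ω φ)
    {x : Space N} (hx : x ∉ Ω) : gradient φ x = 0 := by
  have h0 : φ =ᶠ[𝓝 x] fun _ => (0 : ℝ) :=
    notMem_tsupport_iff_eventuallyEq.1 fun h' => hx (h.2.2 h')
  simp [gradient, h0.fderiv_eq]

theorem IsTest.lap_eq_zero {Ω : Set (Space N)} {φ : Space N → ℝ} (h : IsTest Ω φ)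
    {x : Space N} (hx : x ∉ Ω) : lap φ x = 0 :=
  lap_eq_zero_of_notMem_tsupport fun h' => hx (h.2.2 h')

theorem IsTest.setIntegral_inner_gradient_left {Ω : Set (Space N)} {f g : Space N → ℝ}
    (hf : IsTest Ω f) (hg : ContDiff ℝ 2 g) :
    ∫ x in Ω, inner ℝ (gradient f x) (gradient g x) = -∫ x in Ω, f x * lap g x := by
  rw [setIntegral_eq_integral_of_forall_compl_eq_zero fun x hx => by
      simp [hf.gradient_eq_zero hx],
    setIntegral_eq_integral_of_forall_compl_eq_zero fun x hx => by simp [hf.eq_zero hx],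
    integral_inner_gradient_gradient (hf.contDiff 1) hg (Or.inl hf.2.1)]

/-- The weak gradient of a function in `W_0^{1,2}` pairs with test functions as expected. -/
theorem MemW0.setIntegral_inner_gradient {Ω : Set (Space N)} {w : Space N → ℝ}
    {g : Space N → Space N} (h : MemW0 Ω w g) {ψ : Space N → ℝ} (hψ : IsTest Ω ψ) :
    ∫ x in Ω, inner ℝ (g x) (gradient ψ x) = -∫ x in Ω, w x * lap ψ x := by
  obtain ⟨hw, hg, φ, hφ, h1, h2⟩ := h
  have hl : MemLp (lap ψ) 2 (volume.restrict Ω) :=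
    (continuous_lap (hψ.contDiff 2)).memLp_of_hasCompactSupport (hasCompactSupport_lap hψ.2.1)
  have a1 := tendsto_integral_inner (fun k => (hφ k).memLp_gradient) hg
    (fun _ => hψ.memLp_gradient) hψ.memLp_gradient h2 (by simp)
  have a2 := tendsto_integral_mul (fun k => (hφ k).memLp) hw (fun _ => hl) hl h1 (by simp)
  refine tendsto_nhds_unique a1 (a2.neg.congr fun k => ?_)
  rw [(hφ k).setIntegral_inner_gradient_left (hψ.contDiff 2)]

theorem IsTest.add {Ω : Set (Space N)} {f g : Space N → ℝ} (hf : IsTest Ω f) (hg : IsTest Ω g) :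
    IsTest Ω (f + g) :=
  ⟨hf.1.add hg.1, hf.2.1.add hg.2.1,
    (tsupport_add f g).trans (union_subset hf.2.2 hg.2.2)⟩

theorem IsTest.const_smul {Ω : Set (Space N)} {f : Space N → ℝ} (hf : IsTest Ω f) (c : ℝ) :
    IsTest Ω (c • f) :=
  ⟨contDiff_const.smul hf.1, hf.2.1.smul_left,
    (tsupport_smul_subset_right (fun _ => c) f).trans hf.2.2⟩

theorem IsTest.gradient_add {Ω : Set (Space N)} {f g : Space N → ℝ} (hf : IsTest Ω f)
    (hg : IsTest Ω g) : gradient (f + g) = gradient f + gradient g := by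
  ext1 x
  have h1 := (hf.contDiff 1).differentiable one_ne_zero x
  have h2 := (hg.contDiff 1).differentiable one_ne_zero x
  simp [gradient, fderiv_add h1 h2]

theorem IsTest.gradient_const_smul {Ω : Set (Space N)} {f : Space N → ℝ} (hf : IsTest Ω f)
    (c : ℝ) : gradient (c • f) = c • gradient f := by
  ext1 x
  have h1 := (hf.contDiff 1).differentiable one_ne_zero x
  simp [gradient, fderiv_const_smul h1 c]

/-- The pairs `(φ, ∇φ)` with `φ ∈ C_c^∞(Ω)`, as a subspace of `L²(Ω) × L²(Ω; ℝ^N)`. -/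
def testGraph (Ω : Set (Space N)) :
    Submodule ℝ (WithLp 2 (Lp ℝ 2 (volume.restrict Ω) × Lp (Space N) 2 (volume.restrict Ω))) where
  carrier := {p | ∃ (φ : Space N → ℝ) (h : IsTest Ω φ),
    p = WithLp.toLp 2 (h.memLp.toLp φ, h.memLp_gradient.toLp (gradient φ))}
  add_mem' := by
    rintro _ _ ⟨φ, h, rfl⟩ ⟨ψ, h', rfl⟩
    refine ⟨φ + ψ, h.add h', ?_⟩
    rw [← WithLp.toLp_add, Prod.mk_add_mk, ← MemLp.toLp_add, ← MemLp.toLp_add]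
    simp only [h.gradient_add h']
  zero_mem' := by
    have h0 : IsTest Ω (0 : Space N → ℝ) :=
      ⟨contDiff_const, HasCompactSupport.zero, by simp [tsupport]⟩
    refine ⟨0, h0, ?_⟩
    have hg : gradient (0 : Space N → ℝ) = 0 := by
      ext1 x
      simp [gradient]
    simp only [hg, MemLp.toLp_zero]
    rfl
  smul_mem' := by
    rintro c _ ⟨φ, h, rfl⟩
    refine ⟨c • φ, h.const_smul c, ?_⟩
    rw [← WithLp.toLp_smul, Prod.smul_mk, ← MemLp.toLp_const_smul, ← MemLp.toLp_const_smul]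
    simp only [h.gradient_const_smul]

/-- A pair orthogonal to everything that is orthogonal to all pairs `(φ, ∇φ)` belongs to
`W_0^{1,2}`. -/
theorem memW0_of_forall_orthogonal {Ω : Set (Space N)} {w : Space N → ℝ} {g : Space N → Space N}
    (hw : MemLp w 2 (volume.restrict Ω)) (hg : MemLp g 2 (volume.restrict Ω))
    (H : ∀ (a : Space N → ℝ) (b : Space N → Space N), MemLp a 2 (volume.restrict Ω) →
      MemLp b 2 (volume.restrict Ω) →
      (∀ φ, IsTest Ω φ →
        (∫ x in Ω, φ x * a x) + ∫ x in Ω, inner ℝ (gradient φ x) (b x) = 0) →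
      (∫ x in Ω, w x * a x) + ∫ x in Ω, inner ℝ (g x) (b x) = 0) :
    MemW0 Ω w g := by
  set p : WithLp 2 (Lp ℝ 2 (volume.restrict Ω) × Lp (Space N) 2 (volume.restrict Ω)) :=
    WithLp.toLp 2 (hw.toLp w, hg.toLp g) with hp
  have hmem : p ∈ (testGraph Ω).topologicalClosure := by
    -- In a Hilbert space the closure of a subspace is its double orthogonal complement, so
    -- membership in the closure can be tested by duality.
    rw [← Submodule.orthogonal_orthogonal_eq_closure, Submodule.mem_orthogonal']
    intro q hq
    have hpair : ∀ {f : Space N → ℝ} {h : Space N → Space N} (hf : MemLp f 2 (volume.restrict Ω))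
        (hh : MemLp h 2 (volume.restrict Ω)),
        inner ℝ (WithLp.toLp 2 (hf.toLp f, hh.toLp h)) q =
          (∫ x in Ω, f x * q.ofLp.1 x) + ∫ x in Ω, inner ℝ (h x) (q.ofLp.2 x) := by
      intro f h hf hh
      rw [WithLp.prod_inner_apply]
      dsimp only
      rw [inner_toLp_left, inner_toLp_left]
      simp [mul_comm]
    rw [hp, hpair]
    refine H _ _ (Lp.memLp _) (Lp.memLp _) fun φ hφ => ?_
    rw [← hpair hφ.memLp hφ.memLp_gradient]
    exact (Submodule.mem_orthogonal _ _).1 hq _ ⟨φ, hφ, rfl⟩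
  obtain ⟨q, hq, hlim⟩ := mem_closure_iff_seq_limit.1 hmem
  choose φ hφ hqφ using hq
  refine ⟨hw, hg, φ, hφ, ?_, ?_⟩
  · refine (Lp.tendsto_Lp_iff_tendsto_eLpNorm'' φ (fun k => (hφ k).memLp) w hw).1 ?_
    have := ((WithLp.prod_continuous_ofLp 2 _ _).fst.tendsto p).comp hlim
    refine this.congr fun k => ?_
    simp [hqφ k]
  · refine (Lp.tendsto_Lp_iff_tendsto_eLpNorm'' (fun k => gradient (φ k))
      (fun k => (hφ k).memLp_gradient) g hg).1 ?_
    have := ((WithLp.prod_continuous_ofLp 2 _ _).snd.tendsto p).comp hlim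
    refine this.congr fun k => ?_
    simp [hqφ k]

/-! ### The slice estimate behind the comparison principle -/

theorem contDiff_smoothTransition : ContDiff ℝ ∞ Real.smoothTransition :=
  Real.smoothTransition.contDiff (n := ⊤)

theorem deriv_smoothTransition_nonneg (s : ℝ) : 0 ≤ deriv Real.smoothTransition s :=
  Real.smoothTransition.monotone.deriv_nonneg

theorem deriv_smoothTransition_of_neg {s : ℝ} (hs : s < 0) : deriv Real.smoothTransition s = 0 := by
  have : Real.smoothTransition =ᶠ[𝓝 s] fun _ => (0 : ℝ) := by
    filter_upwards [Iio_mem_nhds hs] with y hy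
    exact Real.smoothTransition.zero_of_nonpos (le_of_lt hy)
  rw [this.deriv_eq]
  simp

theorem deriv_smoothTransition_of_one_lt {s : ℝ} (hs : 1 < s) :
    deriv Real.smoothTransition s = 0 := by
  have : Real.smoothTransition =ᶠ[𝓝 s] fun _ => (1 : ℝ) := by
    filter_upwards [Ioi_mem_nhds hs] with y hy
    exact Real.smoothTransition.one_of_one_le (le_of_lt hy)
  rw [this.deriv_eq]
  simp

theorem continuous_deriv_smoothTransition : Continuous (deriv Real.smoothTransition) :=
  contDiff_smoothTransition.continuous_deriv (by simp)

/-- The derivative vanishes outside `[0, 1]`, so compactness gives a global bound, and the mean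
value inequality makes the same `L` a Lipschitz constant. -/
theorem exists_deriv_smoothTransition_le :
    ∃ L : ℝ, 0 ≤ L ∧ (∀ s, deriv Real.smoothTransition s ≤ L) ∧
      ∀ s t, |Real.smoothTransition s - Real.smoothTransition t| ≤ L * |s - t| := by
  obtain ⟨L, hL⟩ := (isCompact_Icc (a := (0 : ℝ)) (b := 1)).exists_bound_of_continuousOn
    continuous_deriv_smoothTransition.continuousOn
  have h0 : 0 ≤ L := (norm_nonneg _).trans (hL 0 (by simp))
  have hb : ∀ s, ‖deriv Real.smoothTransition s‖ ≤ L := by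
    intro s
    rcases lt_or_ge s 0 with h | h
    · simpa [deriv_smoothTransition_of_neg h] using h0
    rcases lt_or_ge 1 s with h' | h'
    · simpa [deriv_smoothTransition_of_one_lt h'] using h0
    exact hL s ⟨h, h'⟩
  refine ⟨L, h0, fun s => (le_abs_self _).trans (hb s), fun s t => ?_⟩
  have := Convex.norm_image_sub_le_of_norm_deriv_le (f := Real.smoothTransition) (s := univ)
    (x := t) (y := s)
    (fun x _ => (contDiff_smoothTransition.differentiable (by simp)) x) (fun x _ => hb x)
    convex_univ (mem_univ _) (mem_univ _)
  simpa using this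

/-- If `φ` is a test function on `Ω` and `S ≥ 0` on `Ω` then the smoothed positive part of `φ - S`,
extended by zero, is a test function. -/
theorem IsTest.smoothTransition_sub {Ω : Set (Space N)} (hΩo : IsOpen Ω) {φ S : Space N → ℝ}
    (hφ : IsTest Ω φ) (hS : ContDiff ℝ ∞ S) (hS0 : ∀ x ∈ Ω, 0 ≤ S x) :
    IsTest Ω (Ω.indicator fun x => Real.smoothTransition (φ x - S x)) := by
  -- Where `φ` vanishes the argument is `-S ≤ 0` and the transition function is zero. The sign of
  -- `S` is what keeps the support inside that of `φ`.
  have hsupp : ∀ x ∉ tsupport φ, Ω.indicator (fun x => Real.smoothTransition (φ x - S x)) x = 0 := by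
    intro x hx
    by_cases hxΩ : x ∈ Ω
    · rw [indicator_of_mem hxΩ, image_eq_zero_of_notMem_tsupport hx]
      exact Real.smoothTransition.zero_of_nonpos (by linarith [hS0 x hxΩ])
    · simp [hxΩ]
  have hts : tsupport (Ω.indicator fun x => Real.smoothTransition (φ x - S x)) ⊆ tsupport φ := by
    refine closure_minimal (fun x hx => ?_) (isClosed_tsupport φ)
    by_contra h
    exact hx (hsupp x h)
  refine ⟨contDiff_iff_contDiffAt.2 fun x => ?_, hφ.2.1.of_isClosed_subset (isClosed_tsupport _) hts,
    hts.trans hφ.2.2⟩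
  by_cases hxΩ : x ∈ Ω
  · have : ContDiffAt ℝ ∞ (fun x => Real.smoothTransition (φ x - S x)) x :=
      (contDiff_smoothTransition.comp (hφ.1.sub hS)).contDiffAt
    refine this.congr_of_eventuallyEq ?_
    filter_upwards [hΩo.mem_nhds hxΩ] with y hy
    rw [indicator_of_mem hy]
  · have hx : x ∉ tsupport φ := fun h => hxΩ (hφ.2.2 h)
    refine (contDiffAt_const (c := (0 : ℝ))).congr_of_eventuallyEq ?_
    filter_upwards [(isClosed_tsupport φ).isOpen_compl.mem_nhds hx] with y hy
    exact hsupp y hy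

theorem gradient_smoothTransition_sub {Ω : Set (Space N)} (hΩo : IsOpen Ω) {φ S : Space N → ℝ}
    (hφ : ContDiff ℝ 1 φ) (hS : ContDiff ℝ 1 S) {x : Space N} (hx : x ∈ Ω) :
    gradient (Ω.indicator fun x => Real.smoothTransition (φ x - S x)) x =
      deriv Real.smoothTransition (φ x - S x) • (gradient φ x - gradient S x) := by
  have h1 : (Ω.indicator fun x => Real.smoothTransition (φ x - S x)) =ᶠ[𝓝 x]
      fun x => Real.smoothTransition (φ x - S x) := by
    filter_upwards [hΩo.mem_nhds hx] with y hy
    rw [indicator_of_mem hy]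
  have h2 : HasFDerivAt (fun x => φ x - S x) (fderiv ℝ φ x - fderiv ℝ S x) x :=
    ((hφ.differentiable one_ne_zero x).hasFDerivAt).sub
      ((hS.differentiable one_ne_zero x).hasFDerivAt)
  have h3 : HasDerivAt Real.smoothTransition (deriv Real.smoothTransition (φ x - S x)) (φ x - S x) :=
    ((contDiff_smoothTransition.differentiable (by simp)) _).hasDerivAt
  have h4 : HasFDerivAt (fun x => Real.smoothTransition (φ x - S x))
      (deriv Real.smoothTransition (φ x - S x) • (fderiv ℝ φ x - fderiv ℝ S x)) x := by
    have := h3.comp_hasFDerivAt x h2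
    exact this
  rw [gradient, h1.fderiv_eq, h4.fderiv]
  simp [gradient]

/-- Testing a differential inequality for `p ∈ W_0^{1,2}(Ω)` with the smoothed positive part of
`p - S`, where `S ≥ 0` is smooth. -/
theorem MemW0.integral_mul_smoothTransition_nonpos {Ω : Set (Space N)} (hΩo : IsOpen Ω)
    (hΩb : Bornology.IsBounded Ω) {p : Space N → ℝ} {P : Space N → Space N} (hp : MemW0 Ω p P)
    {S : Space N → ℝ} (hS : ContDiff ℝ ∞ S) (hS0 : ∀ x ∈ Ω, 0 ≤ S x) {q : Space N → ℝ}
    (hq : MemLp q 2 (volume.restrict Ω)) {c : ℝ}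
    (h : ∀ ψ, IsTest Ω ψ → (∀ x, 0 ≤ ψ x) →
      (∫ x in Ω, q x * ψ x) + ∫ x in Ω, inner ℝ (P x) (gradient ψ x) ≤ c * ∫ x in Ω, ψ x) :
    ∫ x in Ω, (q x - c - lap S x) * Real.smoothTransition (p x - S x) ≤ 0 := by
  obtain ⟨hpL, hPL, φ, hφ, h1, h2⟩ := hp
  obtain ⟨L, hL0, hL, hLip⟩ := exists_deriv_smoothTransition_le
  have : IsFiniteMeasure ((volume : Measure (Space N)).restrict Ω) :=
    ⟨by simpa using hΩb.measure_lt_top⟩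
  have hS1 : ContDiff ℝ 1 S := contDiff_infty.1 hS 1
  have hS2 : ContDiff ℝ 2 S := contDiff_infty.1 hS 2
  have hSL : MemLp S 2 (volume.restrict Ω) := memLp_two_of_continuous hΩb hS.continuous
  have hGS : MemLp (gradient S) 2 (volume.restrict Ω) :=
    memLp_two_of_continuous hΩb (continuous_gradient hS1)
  have hLS : MemLp (lap S) 2 (volume.restrict Ω) :=
    memLp_two_of_continuous hΩb (continuous_lap hS2)
  set ψ : ℕ → Space N → ℝ := fun k =>
    Ω.indicator fun x => Real.smoothTransition (φ k x - S x) with hψdef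
  have hψ : ∀ k, IsTest Ω (ψ k) := fun k => (hφ k).smoothTransition_sub hΩo hS hS0
  have hψ0 : ∀ k x, 0 ≤ ψ k x := fun k x =>
    indicator_nonneg (fun x _ => Real.smoothTransition.nonneg _) x
  have hψΩ : ∀ k, ∀ x ∈ Ω, ψ k x = Real.smoothTransition (φ k x - S x) := fun k x hx =>
    indicator_of_mem hx _
  have hfac : MemLp (fun x => q x - c - lap S x) 2 (volume.restrict Ω) :=
    (hq.sub (memLp_const c)).sub hLS
  have hβL : MemLp (fun x => Real.smoothTransition (p x - S x)) 2 (volume.restrict Ω) := by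
    refine MemLp.of_bound (Real.smoothTransition.continuous.comp_aestronglyMeasurable
      (hpL.1.sub hSL.1)) 1 (Eventually.of_forall fun x => ?_)
    rw [Real.norm_of_nonneg (Real.smoothTransition.nonneg _)]
    exact Real.smoothTransition.le_one _
  have hψlim : Tendsto (fun k => eLpNorm (fun x => ψ k x - Real.smoothTransition (p x - S x)) 2
      (volume.restrict Ω)) atTop (𝓝 0) := by
    have hz : Tendsto (fun k => ENNReal.ofReal L *
        eLpNorm (fun x => φ k x - p x) 2 (volume.restrict Ω)) atTop (𝓝 0) := by
      simpa using ENNReal.Tendsto.const_mul h1 (Or.inr ENNReal.ofReal_ne_top)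
    refine tendsto_of_tendsto_of_tendsto_of_le_of_le tendsto_const_nhds hz (fun _ => zero_le) ?_
    intro k
    refine eLpNorm_le_mul_eLpNorm_of_ae_le_mul ?_ _
    refine (ae_restrict_iff' hΩo.measurableSet).2 (Eventually.of_forall fun x hx => ?_)
    rw [hψΩ k x hx, Real.norm_eq_abs, Real.norm_eq_abs]
    refine (hLip _ _).trans_eq ?_
    congr 2
    ring
  have hlim1 := tendsto_integral_mul (fun _ => hfac) hfac (fun k => (hψ k).memLp) hβL
    (by simp) hψlim
  have hA : ∀ k, MemLp (fun x => ‖P x - gradient (φ k) x‖) 2 (volume.restrict Ω) := fun k =>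
    (hPL.sub (hφ k).memLp_gradient).norm
  have hB : ∀ k, MemLp (fun x => ‖gradient (φ k) x - gradient S x‖) 2 (volume.restrict Ω) :=
    fun k => ((hφ k).memLp_gradient.sub hGS).norm
  have hB' : MemLp (fun x => ‖P x - gradient S x‖) 2 (volume.restrict Ω) := (hPL.sub hGS).norm
  have hlim2 := tendsto_integral_mul (f' := fun _ => (0 : ℝ)) (h' := fun x => ‖P x - gradient S x‖)
    hA (by simp) hB hB'
    (by
      refine h2.congr fun k => ?_
      refine eLpNorm_congr_norm_ae (Eventually.of_forall fun x => ?_)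
      simp [norm_sub_rev])
    (by
      refine tendsto_of_tendsto_of_tendsto_of_le_of_le tendsto_const_nhds h2
        (fun _ => zero_le) fun k => ?_
      refine eLpNorm_mono_ae (Eventually.of_forall fun x => ?_)
      refine (abs_norm_sub_norm_le _ _).trans_eq ?_
      congr 1
      abel)
  simp only [zero_mul, integral_zero] at hlim2
  refine le_of_tendsto_of_tendsto' hlim1 (by simpa using hlim2.const_mul L) fun k => ?_
  have hk := h (ψ k) (hψ k) (hψ0 k)
  have hgreen : ∫ x in Ω, inner ℝ (gradient S x) (gradient (ψ k) x) =
      -∫ x in Ω, ψ k x * lap S x := by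
    rw [← (hψ k).setIntegral_inner_gradient_left hS2]
    simp only [real_inner_comm]
  have iAB : Integrable (fun x => ‖P x - gradient (φ k) x‖ * ‖gradient (φ k) x - gradient S x‖)
      (volume.restrict Ω) := (hA k).integrable_mul (hB k)
  have hpt : (∫ x in Ω, (inner ℝ (gradient S x) (gradient (ψ k) x) -
      L * (‖P x - gradient (φ k) x‖ * ‖gradient (φ k) x - gradient S x‖))) ≤
      ∫ x in Ω, inner ℝ (P x) (gradient (ψ k) x) := by
    refine setIntegral_mono_on ?_ ?_ hΩo.measurableSet fun x hx => ?_
    · exact (integrable_inner_of_memLp hGS (hψ k).memLp_gradient).sub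
        (iAB.const_mul L)
    · exact integrable_inner_of_memLp hPL (hψ k).memLp_gradient
    · rw [hψdef, gradient_smoothTransition_sub hΩo ((hφ k).contDiff 1) hS1 hx]
      set d := deriv Real.smoothTransition (φ k x - S x)
      have hd0 : 0 ≤ d := deriv_smoothTransition_nonneg _
      have hd1 : d ≤ L := hL _
      set B := gradient (φ k) x - gradient S x with hBdef
      -- With `B = ∇φ_k - ∇S` and `∇ψ_k = d B`, this splits `P · ∇ψ_k` into an error term, the term
      -- `d |B|² ≥ 0`, which is dropped, and `∇S · ∇ψ_k`, which Green's identity turns into the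
      -- Laplacian of `S`.
      have e : P x = (P x - gradient (φ k) x) + (B + gradient S x) := by
        rw [hBdef]; abel
      have hcs := abs_le.1 (abs_real_inner_le_norm (P x - gradient (φ k) x) B)
      have hbb : 0 ≤ inner ℝ B B := real_inner_self_nonneg
      have expd : inner ℝ (P x) (d • B) = d * inner ℝ (P x - gradient (φ k) x) B +
          (d * inner ℝ B B + inner ℝ (gradient S x) (d • B)) := by
        conv_lhs => rw [e]
        rw [inner_add_left, inner_add_left, real_inner_smul_right, real_inner_smul_right]
      rw [expd]
      have n1 : 0 ≤ ‖P x - gradient (φ k) x‖ * ‖B‖ := by positivity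
      nlinarith [mul_le_mul_of_nonneg_left hcs.1 hd0, mul_le_mul_of_nonneg_right hd1 n1,
        mul_nonneg hd0 hbb]
  rw [integral_sub (integrable_inner_of_memLp hGS (hψ k).memLp_gradient)
    (iAB.const_mul L), hgreen, integral_const_mul] at hpt
  have i1 : Integrable (fun x => q x * ψ k x) (volume.restrict Ω) :=
    hq.integrable_mul (hψ k).memLp
  have i2 : Integrable (fun x => ψ k x) (volume.restrict Ω) :=
    (hψ k).memLp.integrable (by norm_num)
  have i3 : Integrable (fun x => ψ k x * lap S x) (volume.restrict Ω) :=
    (hψ k).memLp.integrable_mul hLS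
  have i4 : Integrable (fun x => q x * ψ k x - c * ψ k x) (volume.restrict Ω) :=
    i1.sub (i2.const_mul c)
  have hsplit : ∫ x in Ω, (q x - c - lap S x) * ψ k x =
      (∫ x in Ω, q x * ψ k x) - c * (∫ x in Ω, ψ k x) - ∫ x in Ω, ψ k x * lap S x := by
    rw [← integral_const_mul, ← integral_sub i1 (i2.const_mul c),
      ← integral_sub i4 i3]
    refine integral_congr_ae (Eventually.of_forall fun x => ?_)
    ring
  rw [hsplit]
  linarith

/-! ### Weighted averages in time -/

theorem sq_integral_le_of_memLp {α : Type*} {mα : MeasurableSpace α} {μ : Measure α}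
    [IsFiniteMeasure μ] {h : α → ℝ} (hh : MemLp h 2 μ) :
    (∫ s, h s ∂μ) ^ 2 ≤ μ.real univ * ∫ s, h s ^ 2 ∂μ := by
  have i1 : Integrable h μ := hh.integrable (by norm_num)
  have i2 : Integrable (fun s => h s ^ 2) μ := hh.integrable_sq
  have key : ∀ l : ℝ, 0 ≤ (∫ s, h s ^ 2 ∂μ) - 2 * l * (∫ s, h s ∂μ) + l ^ 2 * μ.real univ := by
    intro l
    have h0 : 0 ≤ ∫ s, (h s - l) ^ 2 ∂μ := integral_nonneg fun s => sq_nonneg _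
    have e : ∀ s, (h s - l) ^ 2 = h s ^ 2 - 2 * l * h s + l ^ 2 := fun s => by ring
    have i3 : Integrable (fun s => h s ^ 2 - 2 * l * h s) μ := i2.sub (i1.const_mul _)
    simp only [e] at h0
    rw [integral_add i3 (integrable_const _), integral_sub i2 (i1.const_mul _),
      integral_const_mul, integral_const, smul_eq_mul] at h0
    linarith
  rcases eq_or_lt_of_le (measureReal_nonneg (μ := μ) (s := univ)) with h0 | h0
  · have : μ = 0 := by
      rw [← Measure.measure_univ_eq_zero]
      exact (measureReal_eq_zero_iff).1 h0.symm
    simp [this]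
  -- The quadratic in `l` is evaluated at its minimiser, the mean of `h`.
  · have := key ((∫ s, h s ∂μ) / μ.real univ)
    field_simp at this
    nlinarith

/-- The average `∫ k(s) f(s, x) dμ(s)` of `f` in its first variable. -/
def timeAvg {F : Type*} [NormedAddCommGroup F] [NormedSpace ℝ F] (μ : Measure ℝ) (k : ℝ → ℝ)
    (f : ℝ × Space N → F) (x : Space N) : F := ∫ s, k s • f (s, x) ∂μ

section TimeAvg

variable {F : Type*} [NormedAddCommGroup F] {μ : Measure ℝ} {ν : Measure (Space N)}

theorem memLp_smul_of_bound [NormedSpace ℝ F] {k : ℝ → ℝ} {C : ℝ} (hk : Continuous k)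
    (hC : ∀ s, |k s| ≤ C) {f : ℝ × Space N → F} (hf : MemLp f 2 (μ.prod ν)) :
    MemLp (fun z => k z.1 • f z) 2 (μ.prod ν) := by
  refine hf.of_le_mul (c := C) ((hk.comp continuous_fst).aestronglyMeasurable.smul hf.1)
    (Eventually.of_forall fun z => ?_)
  rw [norm_smul]
  exact mul_le_mul_of_nonneg_right (hC _) (norm_nonneg _)

theorem ae_memLp_slice [IsFiniteMeasure μ] [IsFiniteMeasure ν] {f : ℝ × Space N → F}
    (hf : MemLp f 2 (μ.prod ν)) :
    ∀ᵐ x ∂ν, MemLp (fun s => f (s, x)) 2 μ := by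
  have h1 : Integrable f (μ.prod ν) := hf.integrable (by norm_num)
  have h2 : Integrable (fun z => ‖f z‖ ^ 2) (μ.prod ν) := hf.norm.integrable_sq
  filter_upwards [h1.prod_left_ae, h2.prod_left_ae] with x hx1 hx2
  exact (memLp_two_iff_integrable_sq_norm hx1.1).2 hx2

/-- Cauchy–Schwarz in time for almost every `x`, followed by Fubini. -/
theorem memLp_timeAvg [NormedSpace ℝ F] [IsFiniteMeasure μ] [IsFiniteMeasure ν]
    {k : ℝ → ℝ} {C : ℝ} (hk : Continuous k) (hC : ∀ s, |k s| ≤ C)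
    {f : ℝ × Space N → F} (hf : MemLp f 2 (μ.prod ν)) :
    MemLp (timeAvg μ k f) 2 ν := by
  have hf' := memLp_smul_of_bound hk hC hf
  have h1 : Integrable (fun z => k z.1 • f z) (μ.prod ν) := hf'.integrable (by norm_num)
  have h2 : Integrable (fun z => ‖k z.1 • f z‖ ^ 2) (μ.prod ν) := hf'.norm.integrable_sq
  have hm : AEStronglyMeasurable (timeAvg μ k f) ν := h1.integral_prod_right.1
  refine (memLp_two_iff_integrable_sq_norm hm).2 ?_
  refine (h2.integral_prod_right.const_mul (μ.real univ)).mono (hm.norm.pow 2) ?_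
  filter_upwards [ae_memLp_slice hf'] with x hx
  have a1 : ‖timeAvg μ k f x‖ ≤ ∫ s, ‖k s • f (s, x)‖ ∂μ := norm_integral_le_integral_norm _
  have a2 := sq_integral_le_of_memLp hx.norm
  rw [Real.norm_of_nonneg (sq_nonneg _)]
  refine le_trans ?_ (le_abs_self _)
  exact (pow_le_pow_left₀ (norm_nonneg _) a1 2).trans a2

theorem integrable_smul_inner [IsFiniteMeasure μ] [IsFiniteMeasure ν]
    {E : Type*} [NormedAddCommGroup E] [InnerProductSpace ℝ E]
    {k : ℝ → ℝ} {C : ℝ} (hk : Continuous k) (hC : ∀ s, |k s| ≤ C)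
    {f : ℝ × Space N → E} (hf : MemLp f 2 (μ.prod ν)) {a : Space N → E} (ha : MemLp a 2 ν) :
    Integrable (fun z : ℝ × Space N => k z.1 * inner ℝ (f z) (a z.2)) (μ.prod ν) := by
  have := integrable_inner_of_memLp (memLp_smul_of_bound hk hC hf) (ha.comp_snd μ)
  simpa only [real_inner_smul_left] using this

theorem integral_inner_timeAvg [IsFiniteMeasure μ] [IsFiniteMeasure ν]
    {E : Type*} [NormedAddCommGroup E] [InnerProductSpace ℝ E]
    [CompleteSpace E]
    {k : ℝ → ℝ} {C : ℝ} (hk : Continuous k) (hC : ∀ s, |k s| ≤ C)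
    {f : ℝ × Space N → E} (hf : MemLp f 2 (μ.prod ν)) {a : Space N → E} (ha : MemLp a 2 ν) :
    ∫ x, inner ℝ (timeAvg μ k f x) (a x) ∂ν =
      ∫ z, k z.1 * inner ℝ (f z) (a z.2) ∂(μ.prod ν) := by
  rw [integral_prod_symm _ (integrable_smul_inner hk hC hf ha)]
  refine integral_congr_ae ?_
  have h1 : Integrable (fun z => k z.1 • f z) (μ.prod ν) :=
    (memLp_smul_of_bound hk hC hf).integrable (by norm_num)
  filter_upwards [h1.prod_left_ae] with x hx
  rw [timeAvg, real_inner_comm, ← integral_inner hx]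
  refine integral_congr_ae (Eventually.of_forall fun s => ?_)
  simp only [real_inner_smul_right, real_inner_comm]

theorem integral_mul_timeAvg [IsFiniteMeasure μ] [IsFiniteMeasure ν]
    {k : ℝ → ℝ} {C : ℝ} (hk : Continuous k) (hC : ∀ s, |k s| ≤ C)
    {f : ℝ × Space N → ℝ} (hf : MemLp f 2 (μ.prod ν)) {a : Space N → ℝ} (ha : MemLp a 2 ν) :
    ∫ x, timeAvg μ k f x * a x ∂ν = ∫ z, k z.1 * (f z * a z.2) ∂(μ.prod ν) := by
  have := integral_inner_timeAvg hk hC hf ha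
  simpa [mul_comm] using this

end TimeAvg

/-- Averages in time of a family in `W_0^{1,2}` are in `W_0^{1,2}`. -/
theorem memW0_timeAvg {Ω : Set (Space N)} [IsFiniteMeasure ((volume : Measure (Space N)).restrict Ω)]
    {μ : Measure ℝ} [IsFiniteMeasure μ] {k : ℝ → ℝ} {C : ℝ} (hk : Continuous k)
    (hC : ∀ s, |k s| ≤ C) {U : ℝ × Space N → ℝ} {G : ℝ × Space N → Space N}
    (hU : MemLp U 2 (μ.prod (volume.restrict Ω))) (hG : MemLp G 2 (μ.prod (volume.restrict Ω)))
    (h : ∀ᵐ s ∂μ, MemW0 Ω (fun x => U (s, x)) (fun x => G (s, x))) :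
    MemW0 Ω (timeAvg μ k U) (timeAvg μ k G) := by
  -- Arguing by duality reduces the claim to Fubini and the orthogonality on almost every slice. No
  -- approximating sequence has to be chosen measurably in `s`.
  refine memW0_of_forall_orthogonal (memLp_timeAvg hk hC hU) (memLp_timeAvg hk hC hG) ?_
  intro a b ha hb hab
  have i1 := integrable_smul_inner hk hC hU ha
  have i2 := integrable_smul_inner hk hC hG hb
  rw [integral_inner_timeAvg hk hC hG hb]
  have e1 := integral_inner_timeAvg hk hC hU ha
  simp only [RCLike.inner_apply, conj_trivial] at e1 i1
  simp only [mul_comm (timeAvg μ k U _)]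
  have i3 : Integrable (fun z : ℝ × Space N => k z.1 * (a z.2 * U z) +
      k z.1 * inner ℝ (G z) (b z.2)) (μ.prod (volume.restrict Ω)) := i1.add i2
  rw [e1, ← integral_add i1 i2, integral_prod _ i3]
  refine integral_eq_zero_of_ae ?_
  filter_upwards [h] with s hs
  obtain ⟨hw, hg, φ, hφ, h1, h2⟩ := hs
  have l1 := tendsto_integral_mul (fun k => (hφ k).memLp) hw (fun _ => ha) ha h1 (by simp)
  have l2 := tendsto_integral_inner (fun k => (hφ k).memLp_gradient) hg (fun _ => hb) hb h2
    (by simp)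
  have l3 := l1.add l2
  simp only [hab _ (hφ _)] at l3
  have l4 := tendsto_nhds_unique tendsto_const_nhds l3
  have j1 : Integrable (fun x => a x * U (s, x)) (volume.restrict Ω) := ha.integrable_mul hw
  have j2 := integrable_inner_of_memLp hg hb
  rw [Pi.zero_apply, integral_add (j1.const_mul _) (j2.const_mul _), integral_const_mul,
    integral_const_mul, ← mul_add]
  simp only [mul_comm (a _)]
  rw [← l4, mul_zero]

/-! ### A comparison principle -/

/-- A primitive of the smooth transition function; it is a smoothed positive part. -/
def smoothPos (y : ℝ) : ℝ := ∫ s in (0 : ℝ)..y, Real.smoothTransition s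

theorem hasDerivAt_smoothPos (y : ℝ) : HasDerivAt smoothPos (Real.smoothTransition y) y :=
  intervalIntegral.integral_hasDerivAt_right
    (Real.smoothTransition.continuous.intervalIntegrable _ _)
    (Real.smoothTransition.continuous.stronglyMeasurableAtFilter _ _)
    Real.smoothTransition.continuous.continuousAt

theorem continuous_smoothPos : Continuous smoothPos :=
  continuous_iff_continuousAt.2 fun y => (hasDerivAt_smoothPos y).continuousAt

theorem abs_smoothPos_le (y : ℝ) : |smoothPos y| ≤ |y| := by
  have := intervalIntegral.norm_integral_le_of_norm_le_const (a := (0 : ℝ)) (b := y) (C := 1)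
    (f := Real.smoothTransition) fun s _ => by
      rw [Real.norm_of_nonneg (Real.smoothTransition.nonneg _)]
      exact Real.smoothTransition.le_one _
  simpa [smoothPos] using this

theorem smoothPos_of_nonpos {y : ℝ} (hy : y ≤ 0) : smoothPos y = 0 := by
  rw [smoothPos, intervalIntegral.integral_symm, intervalIntegral.integral_of_le hy,
    setIntegral_eq_zero_of_forall_eq_zero, neg_zero]
  exact fun s hs => Real.smoothTransition.zero_of_nonpos hs.2

theorem smoothPos_pos {y : ℝ} (hy : 0 < y) : 0 < smoothPos y :=
  intervalIntegral.intervalIntegral_pos_of_pos_on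
    (Real.smoothTransition.continuous.intervalIntegrable _ _)
    (fun _ hs => Real.smoothTransition.pos_of_pos hs.1) hy

theorem smoothPos_nonneg (y : ℝ) : 0 ≤ smoothPos y := by
  rcases le_or_gt y 0 with h | h
  · exact (smoothPos_of_nonpos h).ge
  · exact (smoothPos_pos h).le

/-- Comparison of a family `p t ∈ W_0^{1,2}(Ω)`, differentiable in `t` and satisfying
`∂ₜp - Δp ≤ c(t)` weakly, with a nonnegative smooth `S` satisfying `∂ₜS - ΔS ≥ c(t)`. -/
theorem ae_le_of_weak_subsolution {Ω : Set (Space N)} (hΩo : IsOpen Ω)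
    (hΩb : Bornology.IsBounded Ω) {T : ℝ} {p q S S' : ℝ → Space N → ℝ}
    {P : ℝ → Space N → Space N} {c : ℝ → ℝ} {B : Space N → ℝ} {M : ℝ}
    (hp : ∀ t < T, MemW0 Ω (p t) (P t)) (hq : ∀ t < T, MemLp (q t) 2 (volume.restrict Ω))
    (hpq : ∀ᵐ x ∂volume.restrict Ω, ∀ t, HasDerivAt (fun t => p t x) (q t x) t)
    (hqB : ∀ᵐ x ∂volume.restrict Ω, ∀ t, |q t x| ≤ B x) (hB : Integrable B (volume.restrict Ω))
    (hweak : ∀ t < T, ∀ ψ, IsTest Ω ψ → (∀ x, 0 ≤ ψ x) →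
      (∫ x in Ω, q t x * ψ x) + ∫ x in Ω, inner ℝ (P t x) (gradient ψ x) ≤ c t * ∫ x in Ω, ψ x)
    (hS : ∀ t, ContDiff ℝ ∞ (S t)) (hS0 : ∀ t < T, ∀ x ∈ Ω, 0 ≤ S t x)
    (hSS' : ∀ t x, HasDerivAt (fun t => S t x) (S' t x) t) (hS'c : ∀ t, Continuous (S' t))
    (hM : ∀ t ∈ Ioo (-1) T, ∀ x ∈ Ω, |S' t x| ≤ M)
    (hsup : ∀ t < T, ∀ x ∈ Ω, c t + lap (S t) x ≤ S' t x)
    (hstart : ∀ᵐ x ∂volume.restrict Ω, p 0 x ≤ S 0 x) {t : ℝ} (ht0 : 0 ≤ t) (htT : t < T) :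
    ∀ᵐ x ∂volume.restrict Ω, p t x ≤ S t x := by
  have : IsFiniteMeasure ((volume : Measure (Space N)).restrict Ω) :=
    ⟨by simpa using hΩb.measure_lt_top⟩
  have hΩm := hΩo.measurableSet
  have hW : ∀ t < T, MemLp (fun x => p t x - S t x) 2 (volume.restrict Ω) := fun t ht =>
    (hp t ht).1.sub (memLp_two_of_continuous hΩb (hS t).continuous)
  have hFm : ∀ t < T, AEStronglyMeasurable (fun x => smoothPos (p t x - S t x))
      (volume.restrict Ω) := fun t ht => continuous_smoothPos.comp_aestronglyMeasurable (hW t ht).1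
  have hFi : ∀ t < T, Integrable (fun x => smoothPos (p t x - S t x)) (volume.restrict Ω) :=
    fun t ht => ((hW t ht).integrable (by norm_num)).mono (hFm t ht)
      (Eventually.of_forall fun x => abs_smoothPos_le _)
  have hβm : ∀ t < T, AEStronglyMeasurable (fun x => Real.smoothTransition (p t x - S t x))
      (volume.restrict Ω) := fun t ht =>
    Real.smoothTransition.continuous.comp_aestronglyMeasurable (hW t ht).1
  have hβ1 : ∀ y : ℝ, ‖Real.smoothTransition y‖ ≤ 1 := fun y => by
    rw [Real.norm_of_nonneg (Real.smoothTransition.nonneg _)]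
    exact Real.smoothTransition.le_one _
  have hβL : ∀ t < T, MemLp (fun x => Real.smoothTransition (p t x - S t x)) 2
      (volume.restrict Ω) := fun t ht =>
    MemLp.of_bound (hβm t ht) 1 (Eventually.of_forall fun x => hβ1 _)
  -- The interval starts at `-1` so that the initial time `0` is an interior point and two-sided
  -- derivatives can be used there.
  have hder : ∀ t ∈ Ioo (-1) T, HasDerivAt (fun t => ∫ x in Ω, smoothPos (p t x - S t x))
      (∫ x in Ω, Real.smoothTransition (p t x - S t x) * (q t x - S' t x)) t := by
    intro t ht
    refine (hasDerivAt_integral_of_dominated_loc_of_deriv_le (s := Ioo (-1) T)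
      (F := fun t x => smoothPos (p t x - S t x))
      (F' := fun t x => Real.smoothTransition (p t x - S t x) * (q t x - S' t x))
      (bound := fun x => B x + M) (isOpen_Ioo.mem_nhds ht) ?_ (hFi t ht.2) ?_ ?_ ?_ ?_).2
    · filter_upwards [isOpen_Ioo.mem_nhds ht] with s hs using hFm s hs.2
    · exact (hβm t ht.2).mul ((hq t ht.2).1.sub (hS'c t).aestronglyMeasurable)
    · filter_upwards [hqB, ae_restrict_mem hΩm] with x hx hxΩ s hs
      rw [norm_mul]
      calc _ ≤ 1 * ‖q s x - S' s x‖ := by gcongr; exact hβ1 _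
        _ ≤ ‖q s x‖ + ‖S' s x‖ := by rw [one_mul]; exact norm_sub_le _ _
        _ ≤ B x + M := add_le_add (hx s) (hM s hs x hxΩ)
    · exact hB.add (integrable_const M)
    · filter_upwards [hpq] with x hx s _
      exact (hasDerivAt_smoothPos _).comp s ((hx s).sub (hSS' s x))
  have hder0 : ∀ t ∈ Ioo (-1) T,
      ∫ x in Ω, Real.smoothTransition (p t x - S t x) * (q t x - S' t x) ≤ 0 := by
    intro t ht
    refine le_trans ?_ ((hp t ht.2).integral_mul_smoothTransition_nonpos hΩo hΩb (hS t)
      (hS0 t ht.2) (hq t ht.2) (hweak t ht.2))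
    have hS'L : MemLp (S' t) 2 (volume.restrict Ω) := memLp_two_of_continuous hΩb (hS'c t)
    have hlL : MemLp (lap (S t)) 2 (volume.restrict Ω) :=
      memLp_two_of_continuous hΩb (continuous_lap (contDiff_infty.1 (hS t) 2))
    refine setIntegral_mono_on ((hβL t ht.2).integrable_mul ((hq t ht.2).sub hS'L))
      ((((hq t ht.2).sub (memLp_const (c t))).sub hlL).integrable_mul (hβL t ht.2)) hΩm ?_
    intro x hx
    rw [mul_comm]
    -- The supersolution property `c + ΔS ≤ ∂ₜS` bounds the time derivative of the energy by the
    -- integral already known to be nonpositive.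
    refine mul_le_mul_of_nonneg_right ?_ (Real.smoothTransition.nonneg _)
    linarith [hsup t ht.2 x hx]
  have hanti : AntitoneOn (fun t => ∫ x in Ω, smoothPos (p t x - S t x)) (Ioo (-1) T) := by
    refine antitoneOn_of_deriv_nonpos (convex_Ioo _ _)
      (fun s hs => (hder s hs).continuousAt.continuousWithinAt) ?_ ?_
    · rw [interior_Ioo]
      exact fun s hs => (hder s hs).differentiableAt.differentiableWithinAt
    · rw [interior_Ioo]
      intro s hs
      rw [(hder s hs).deriv]
      exact hder0 s hs
  -- The energy is zero at time `0`, nonincreasing and nonnegative, hence zero at time `t`. As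
  -- `smoothPos` is positive on `(0, ∞)`, this forces `p ≤ S` almost everywhere.
  have hE0 : ∫ x in Ω, smoothPos (p 0 x - S 0 x) = 0 := by
    refine integral_eq_zero_of_ae ?_
    filter_upwards [hstart] with x hx
    exact smoothPos_of_nonpos (by linarith)
  have hEt := hanti ⟨by norm_num, ht0.trans_lt htT⟩ ⟨by linarith, htT⟩ ht0
  simp only [hE0] at hEt
  have hEt0 : ∫ x in Ω, smoothPos (p t x - S t x) = 0 :=
    le_antisymm hEt (integral_nonneg fun x => smoothPos_nonneg _)
  have := (integral_eq_zero_iff_of_nonneg (fun x => smoothPos_nonneg _) (hFi t htT)).1 hEt0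
  filter_upwards [this] with x hx
  by_contra hlt
  exact (smoothPos_pos (y := p t x - S t x) (by linarith)).ne' hx

/-! ### Mollification in time -/

theorem hasDerivAt_timeAvg {μ : Measure ℝ} {k : ℝ → ℝ} {C C' : ℝ} (hk : ContDiff ℝ 1 k)
    (hC : ∀ s, |k s| ≤ C) (hC' : ∀ s, |deriv k s| ≤ C') {U : ℝ × Space N → ℝ} {x : Space N}
    (hU : Integrable (fun s => U (s, x)) μ) (t : ℝ) :
    HasDerivAt (fun t => timeAvg μ (fun s => k (t - s)) U x)
      (timeAvg μ (fun s => deriv k (t - s)) U x) t := by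
  have hc : ∀ t : ℝ, Continuous fun s => k (t - s) := fun t =>
    hk.continuous.comp (continuous_const.sub continuous_id)
  have hc' : Continuous fun s => deriv k (t - s) :=
    (hk.continuous_deriv le_rfl).comp (continuous_const.sub continuous_id)
  refine (hasDerivAt_integral_of_dominated_loc_of_deriv_le (s := univ)
      (F := fun t s => k (t - s) • U (s, x)) (F' := fun t s => deriv k (t - s) • U (s, x))
      (bound := fun s => C' * ‖U (s, x)‖) univ_mem ?_ ?_ ?_ ?_ ?_ ?_).2
  · exact Eventually.of_forall fun t => (hc t).aestronglyMeasurable.smul hU.1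
  · refine (hU.norm.const_mul C).mono ((hc t).aestronglyMeasurable.smul hU.1)
      (Eventually.of_forall fun s => ?_)
    rw [norm_smul]
    exact (mul_le_mul_of_nonneg_right (hC _) (norm_nonneg _)).trans (le_abs_self _)
  · exact hc'.aestronglyMeasurable.smul hU.1
  · refine Eventually.of_forall fun s t _ => ?_
    rw [norm_smul]
    exact mul_le_mul_of_nonneg_right (hC' _) (norm_nonneg _)
  · exact hU.norm.const_mul C'
  · refine Eventually.of_forall fun s t _ => ?_
    have h1 : HasDerivAt (fun t => k (t - s)) (deriv k (t - s)) t :=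
      (hk.differentiable one_ne_zero (t - s)).hasDerivAt.comp_sub_const t s
    exact h1.smul_const _

theorem restrict_cylinder (T : ℝ) (Ω : Set (Space N)) :
    (volume : Measure (ℝ × Space N)).restrict (cylinder T Ω) =
      (volume.restrict (Ioo 0 T)).prod (volume.restrict Ω) := by
  rw [Measure.prod_restrict, cylinder, Measure.volume_eq_prod]

/-- Since `ρ` lives on `[0, ∞)`, the product is supported in times `s ≤ t < T`, so the mollifying
kernel is itself an admissible test function. It need not vanish at `s = 0`; the initial datum
enters there. -/
theorem isTest_mul_comp_sub {Ω : Set (Space N)} {ρ : ℝ → ℝ} (hρ : ContDiff ℝ ∞ ρ)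
    (hρc : HasCompactSupport ρ) (hρ0 : tsupport ρ ⊆ Ici 0) {ψ : Space N → ℝ} (hψ : IsTest Ω ψ)
    {t T : ℝ} (ht : t < T) :
    IsTest (Iio T ×ˢ Ω) (fun z : ℝ × Space N => ρ (t - z.1) * ψ z.2) := by
  have hK : IsCompact (((fun s => t - s) '' tsupport ρ) ×ˢ tsupport ψ) :=
    (hρc.isCompact.image (continuous_const.sub continuous_id)).prod hψ.2.1
  have hsub : tsupport (fun z : ℝ × Space N => ρ (t - z.1) * ψ z.2) ⊆
      ((fun s => t - s) '' tsupport ρ) ×ˢ tsupport ψ := by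
    refine closure_minimal (fun z hz => ?_) hK.isClosed
    have hz' : ρ (t - z.1) * ψ z.2 ≠ 0 := hz
    exact ⟨⟨t - z.1, subset_tsupport _ (left_ne_zero_of_mul hz'), by simp⟩,
      subset_tsupport _ (right_ne_zero_of_mul hz')⟩
  refine ⟨?_, hK.of_isClosed_subset (isClosed_tsupport _) hsub, hsub.trans ?_⟩
  · exact (hρ.comp (contDiff_const.sub contDiff_fst)).mul (hψ.1.comp contDiff_snd)
  · rintro z ⟨⟨s, hs, hsz⟩, hz2⟩
    refine ⟨?_, hψ.2.2 hz2⟩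
    have h0 : 0 ≤ s := hρ0 hs
    have : z.1 = t - s := hsz.symm
    rw [mem_Iio, this]
    linarith

/-- The endpoint `s = T` contributes `ρ(t - T) = 0`. The surviving value `ρ t` is the source term
created by subtracting the constant `b` from `u`. -/
theorem setIntegral_deriv_comp_sub {ρ : ℝ → ℝ} (hρ : ContDiff ℝ 1 ρ)
    (hρ0 : tsupport ρ ⊆ Ici 0) {t T : ℝ} (hT : 0 < T) (ht : t < T) :
    ∫ s in Ioo 0 T, deriv ρ (t - s) = ρ t := by
  rw [← integral_Ioc_eq_integral_Ioo, ← intervalIntegral.integral_of_le hT.le]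
  rw [intervalIntegral.integral_comp_sub_left (fun s => deriv ρ s) t,
    intervalIntegral.integral_deriv_eq_sub (fun x _ => hρ.differentiable one_ne_zero x)
    ((hρ.continuous_deriv le_rfl).intervalIntegrable _ _)]
  have : ρ (t - T) = 0 := image_eq_zero_of_notMem_tsupport fun h => by
    have : 0 ≤ t - T := hρ0 h
    linarith
  simp [this]

/-- The weak formulation, mollified in time with a kernel supported in `[0, ∞)`. -/
theorem weak_timeAvg_le {Ω : Set (Space N)} (hΩb : Bornology.IsBounded Ω)
    {T : ℝ} (hT : 0 < T) {b : ℝ} {f : Space N → ℝ} (hf : ∀ᵐ x ∂volume.restrict Ω, 0 ≤ f x)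
    {u : ℝ × Space N → ℝ} {G : ℝ × Space N → Space N}
    (hu : MemLp u 2 (volume.restrict (cylinder T Ω)))
    (hG : MemLp G 2 (volume.restrict (cylinder T Ω)))
    (hweak : ∀ φ : ℝ × Space N → ℝ, IsTest (Iio T ×ˢ Ω) φ →
      ∫ z in cylinder T Ω,
        (-(u z * deriv (fun s => φ (s, z.2)) z.1) +
          inner ℝ (G z) (gradient (fun y => φ (z.1, y)) z.2)) = ∫ x in Ω, f x * φ (0, x))
    {ρ : ℝ → ℝ} (hρ : ContDiff ℝ ∞ ρ) (hρc : HasCompactSupport ρ) (hρ0 : tsupport ρ ⊆ Ici 0)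
    (hρn : ∀ s, 0 ≤ ρ s) {t : ℝ} (ht : t < T) {ψ : Space N → ℝ} (hψ : IsTest Ω ψ)
    (hψ0 : ∀ x, 0 ≤ ψ x) :
    (∫ x in Ω, timeAvg (volume.restrict (Ioo 0 T)) (fun s => -deriv ρ (t - s))
        (fun z => u z - b) x * ψ x) +
      ∫ x in Ω, inner ℝ (timeAvg (volume.restrict (Ioo 0 T)) (fun s => -ρ (t - s)) G x)
        (gradient ψ x) ≤ b * ρ t * ∫ x in Ω, ψ x := by
  have : IsFiniteMeasure ((volume : Measure (Space N)).restrict Ω) :=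
    ⟨by simpa using hΩb.measure_lt_top⟩
  have hρ1 : ContDiff ℝ 1 ρ := contDiff_infty.1 hρ 1
  have hcs : Continuous fun s : ℝ => t - s := continuous_const.sub continuous_id
  have hc1 : Continuous fun s => -ρ (t - s) := (hρ.continuous.comp hcs).neg
  have hd : Continuous fun s => deriv ρ (t - s) := (hρ1.continuous_deriv le_rfl).comp hcs
  have hdn : Continuous fun s => -deriv ρ (t - s) := hd.neg
  obtain ⟨C, hC⟩ := hρ.continuous.bounded_above_of_compact_support hρc
  obtain ⟨C', hC'⟩ := (hρ1.continuous_deriv le_rfl).bounded_above_of_compact_support hρc.deriv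
  rw [restrict_cylinder] at hu hG
  have hU : MemLp (fun z => u z - b) 2
      ((volume.restrict (Ioo 0 T)).prod (volume.restrict Ω)) := hu.sub (memLp_const b)
  have hCn : ∀ s, |-ρ (t - s)| ≤ C := fun s => by rw [abs_neg]; exact hC _
  have hCn' : ∀ s, |-deriv ρ (t - s)| ≤ C' := fun s => by rw [abs_neg]; exact hC' _
  rw [integral_mul_timeAvg hdn hCn' hU hψ.memLp,
    integral_inner_timeAvg hc1 hCn hG hψ.memLp_gradient]
  have hw := hweak _ (isTest_mul_comp_sub hρ hρc hρ0 hψ ht)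
  have e1 : ∀ z : ℝ × Space N, deriv (fun s => ρ (t - s) * ψ z.2) z.1 =
      -deriv ρ (t - z.1) * ψ z.2 := by
    intro z
    have h1 : HasDerivAt (fun s => ρ (t - s)) (-deriv ρ (t - z.1)) z.1 :=
      (hρ1.differentiable one_ne_zero (t - z.1)).hasDerivAt.comp_const_sub t z.1
    exact (h1.mul_const _).deriv
  have e2 : ∀ z : ℝ × Space N, gradient (fun y => ρ (t - z.1) * ψ y) z.2 =
      ρ (t - z.1) • gradient ψ z.2 := by
    intro z
    have := (hψ.contDiff 1).differentiable one_ne_zero z.2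
    simp [gradient, fderiv_const_mul this]
  simp only [e1, e2, real_inner_smul_right] at hw
  rw [restrict_cylinder] at hw
  have i1 := integrable_smul_inner hdn hCn' hU hψ.memLp
  simp only [RCLike.inner_apply, conj_trivial] at i1
  have i2 := integrable_smul_inner hc1 hCn hG hψ.memLp_gradient
  have i3 : Integrable (fun z : ℝ × Space N => deriv ρ (t - z.1) * ψ z.2)
      ((volume.restrict (Ioo 0 T)).prod (volume.restrict Ω)) := by
    refine Integrable.mul_prod (f := fun s => deriv ρ (t - s)) (g := ψ) ?_
      (hψ.memLp.integrable (by norm_num))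
    exact (hd.integrableOn_Icc (a := 0) (b := T)).mono_set Ioo_subset_Icc_self
  have e3 : ∫ z : ℝ × Space N, deriv ρ (t - z.1) * ψ z.2
      ∂((volume.restrict (Ioo 0 T)).prod (volume.restrict Ω)) = ρ t * ∫ x in Ω, ψ x := by
    rw [integral_prod_mul (fun s => deriv ρ (t - s)) ψ, setIntegral_deriv_comp_sub hρ1 hρ0 hT ht]
  have e4 : ∫ z : ℝ × Space N, (-(u z * (-deriv ρ (t - z.1) * ψ z.2)) +
      ρ (t - z.1) * inner ℝ (G z) (gradient ψ z.2))
      ∂((volume.restrict (Ioo 0 T)).prod (volume.restrict Ω)) =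
      b * (ρ t * ∫ x in Ω, ψ x) -
      ((∫ z : ℝ × Space N, -deriv ρ (t - z.1) * (ψ z.2 * (u z - b))
        ∂((volume.restrict (Ioo 0 T)).prod (volume.restrict Ω))) +
      ∫ z : ℝ × Space N, -ρ (t - z.1) * inner ℝ (G z) (gradient ψ z.2)
        ∂((volume.restrict (Ioo 0 T)).prod (volume.restrict Ω))) := by
    rw [← e3, ← integral_const_mul, ← integral_add i1 i2, ← integral_sub (i3.const_mul b)]
    · refine integral_congr_ae (Eventually.of_forall fun z => ?_)
      dsimp only
      ring
    · exact i1.add i2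
  rw [e4] at hw
  -- The initial term is the only one whose value is not computed. Being nonnegative, it can be
  -- dropped, which turns the identity into an inequality.
  have hpos : 0 ≤ ∫ x in Ω, f x * (ρ (t - 0) * ψ x) := by
    refine integral_nonneg_of_ae ?_
    filter_upwards [hf] with x hx
    exact mul_nonneg hx (mul_nonneg (hρn _) (hψ0 _))
  simp only [mul_comm _ (ψ _)] at hw ⊢
  simp only [mul_comm (ψ _)] at hw hpos ⊢
  linarith

/-! ### The barrier -/

theorem hasFDerivAt_exp_coord (κ : ℝ) (i₀ : Fin N) (x : Space N) :
    HasFDerivAt (fun x : Space N => Real.exp (κ * x i₀))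
      ((κ * Real.exp (κ * x i₀)) • (EuclideanSpace.proj i₀ : Space N →L[ℝ] ℝ)) x := by
  have h1 : HasFDerivAt (fun x : Space N => x i₀) (EuclideanSpace.proj i₀ : Space N →L[ℝ] ℝ) x :=
    (EuclideanSpace.proj i₀ : Space N →L[ℝ] ℝ).hasFDerivAt
  have := (h1.const_mul κ).exp
  rwa [smul_smul, mul_comm] at this

/-- At a fixed time the comparison function `S` has this form, so this is the only Laplacian needed
on the barrier side. The factor `κ ^ 2` matches the growth rate in time of the barrier. -/
theorem lap_add_mul_exp_coord (a d κ : ℝ) (i₀ : Fin N) (x : Space N) :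
    lap (fun x : Space N => a + d * Real.exp (κ * x i₀)) x = d * κ ^ 2 * Real.exp (κ * x i₀) := by
  have h1 : ∀ i : Fin N, (fun y : Space N => fderiv ℝ
      (fun x : Space N => a + d * Real.exp (κ * x i₀)) y (stdVec i)) =
      fun y => (d * κ * stdVec i i₀) * Real.exp (κ * y i₀) := by
    intro i
    funext y
    rw [(((hasFDerivAt_exp_coord κ i₀ y).const_mul d).const_add a).fderiv]
    simp
    ring
  simp only [lap, h1]
  have h2 : ∀ i : Fin N, fderiv ℝ (fun y : Space N => (d * κ * stdVec i i₀) *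
      Real.exp (κ * y i₀)) x (stdVec i) =
      (stdVec i i₀) ^ 2 * (d * κ ^ 2 * Real.exp (κ * x i₀)) := by
    intro i
    rw [((hasFDerivAt_exp_coord κ i₀ x).const_mul _).fderiv]
    simp
    ring
  simp only [h2]
  rw [← Finset.sum_mul]
  have h3 : ∑ i : Fin N, (stdVec i i₀) ^ 2 = 1 := by
    rw [Finset.sum_eq_single i₀]
    · simp [stdVec]
    · intro i _ hi
      simp [stdVec, hi.symm]
    · simp
  rw [h3, one_mul]

/-- A solution of the heat equation, negative for `t < 0` on `{x | x i₀ ≤ A}` and at most `1` for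
`t ≤ T` there. -/
def barrier (T A κ : ℝ) (i₀ : Fin N) (t : ℝ) (x : Space N) : ℝ :=
  Real.exp (-(κ * A) - κ ^ 2 * T) * (Real.exp (κ * x i₀ + κ ^ 2 * t) - Real.exp (κ * A))

theorem barrier_nonpos {T A κ : ℝ} (hκ : 0 ≤ κ) {i₀ : Fin N} {t : ℝ} (ht : t ≤ 0) {x : Space N}
    (hx : x i₀ ≤ A) : barrier T A κ i₀ t x ≤ 0 := by
  refine mul_nonpos_of_nonneg_of_nonpos (Real.exp_nonneg _) ?_
  rw [sub_nonpos, Real.exp_le_exp]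
  nlinarith [sq_nonneg κ]

theorem barrier_le_one {T A κ : ℝ} (hκ : 0 ≤ κ) {i₀ : Fin N} {t : ℝ} (ht : t ≤ T) {x : Space N}
    (hx : x i₀ ≤ A) : barrier T A κ i₀ t x ≤ 1 := by
  have h1 : Real.exp (-(κ * A) - κ ^ 2 * T) * Real.exp (κ * x i₀ + κ ^ 2 * t) ≤ 1 := by
    rw [← Real.exp_add, Real.exp_le_one_iff]
    nlinarith [sq_nonneg κ, mul_le_mul_of_nonneg_left hx hκ]
  rw [barrier, mul_sub]
  have := mul_nonneg (Real.exp_nonneg (-(κ * A) - κ ^ 2 * T)) (Real.exp_nonneg (κ * A))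
  linarith

theorem exists_barrier_pos (T A : ℝ) (i₀ : Fin N) {t : ℝ} (ht : 0 < t) (x : Space N) :
    ∃ κ, 0 ≤ κ ∧ 0 < barrier T A κ i₀ t x := by
  -- This `κ` gives `κ t = |A - x i₀| + 1 > A - x i₀`, that is, `κ x i₀ + κ² t > κ A`.
  refine ⟨(|A - x i₀| + 1) / t, by positivity, ?_⟩
  refine mul_pos (Real.exp_pos _) (sub_pos.2 (Real.exp_lt_exp.2 ?_))
  set κ := (|A - x i₀| + 1) / t with hκ
  have h1 : κ * t = |A - x i₀| + 1 := by rw [hκ]; field_simp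
  have hκ0 : 0 < κ := by positivity
  have : κ * (A - x i₀) < κ * (κ * t) := by
    refine mul_lt_mul_of_pos_left ?_ hκ0
    rw [h1]
    linarith [le_abs_self (A - x i₀)]
  nlinarith

theorem continuous_barrier (T A κ : ℝ) (i₀ : Fin N) :
    Continuous fun z : ℝ × Space N => barrier T A κ i₀ z.1 z.2 := by
  unfold barrier
  fun_prop

/-! ### Lower bound of weak solutions by the barrier -/

/-- A kernel for averaging over the past: smooth, of mass one, supported in `(0, ε)`. -/
theorem exists_kernel {ε : ℝ} (hε : 0 < ε) : ∃ ρ : ℝ → ℝ, ContDiff ℝ ∞ ρ ∧ HasCompactSupport ρ ∧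
    (∀ s, 0 ≤ ρ s) ∧ tsupport ρ ⊆ Ioo 0 ε ∧ ∫ s, ρ s = 1 := by
  let B : ContDiffBump (ε / 2) := ⟨ε / 8, ε / 4, by positivity, by linarith⟩
  refine ⟨B.normed volume, B.contDiff_normed, B.hasCompactSupport_normed,
    fun s => B.nonneg_normed s, ?_, B.integral_normed⟩
  rw [B.tsupport_normed_eq, Real.closedBall_eq_Icc]
  intro s hs
  have h1 : ε / 2 - ε / 4 ≤ s := hs.1
  have h2 : s ≤ ε / 2 + ε / 4 := hs.2
  constructor <;> linarith

theorem setIntegral_kernel_comp_sub {ρ : ℝ → ℝ} {ε : ℝ} (hρs : tsupport ρ ⊆ Ioo 0 ε)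
    (hρ1 : ∫ s, ρ s = 1) {t T : ℝ} (hεt : ε ≤ t) (ht : t < T) :
    ∫ s in Ioo 0 T, ρ (t - s) = 1 := by
  rw [setIntegral_eq_integral_of_forall_compl_eq_zero, integral_sub_left_eq_self ρ volume t, hρ1]
  intro s hs
  refine image_eq_zero_of_notMem_tsupport fun h => hs ?_
  have := hρs h
  exact ⟨by linarith [this.2], by linarith [this.1]⟩

/-- Averages over the past of a weak solution with lateral boundary value `b` and nonnegative
initial value are bounded below by `b` times the (shifted) barrier. -/
theorem IsWeakSolution.mul_barrier_le_timeAvg {Ω : Set (Space N)} (hΩo : IsOpen Ω)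
    (hΩb : Bornology.IsBounded Ω) {T : ℝ} (hT : 0 < T) {b : ℝ} (hb : 0 ≤ b) {f : Space N → ℝ}
    (hf : ∀ᵐ x ∂volume.restrict Ω, 0 ≤ f x) {u : ℝ × Space N → ℝ}
    (hu : IsWeakSolution T Ω b f u) {A κ : ℝ} {i₀ : Fin N} (hκ : 0 ≤ κ)
    (hA : ∀ x ∈ Ω, x i₀ ≤ A) {ρ : ℝ → ℝ} {ε : ℝ} (hε : 0 < ε) (hρ : ContDiff ℝ ∞ ρ)
    (hρc : HasCompactSupport ρ) (hρn : ∀ s, 0 ≤ ρ s) (hρs : tsupport ρ ⊆ Ioo 0 ε)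
    (hρ1 : ∫ s, ρ s = 1) {t : ℝ} (hεt : ε ≤ t) (ht : t < T) :
    ∀ᵐ x ∂volume.restrict Ω, b * barrier T A κ i₀ (t - ε) x ≤
      timeAvg (volume.restrict (Ioo 0 T)) (fun s => ρ (t - s)) u x := by
  obtain ⟨huL, G, hGL, hW0, hweak⟩ := hu
  have : IsFiniteMeasure ((volume : Measure (Space N)).restrict Ω) :=
    ⟨by simpa using hΩb.measure_lt_top⟩
  have hρd : ContDiff ℝ 1 ρ := contDiff_infty.1 hρ 1
  have hρ0 : tsupport ρ ⊆ Ici 0 := hρs.trans fun s hs => le_of_lt hs.1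
  obtain ⟨C, hC⟩ := hρ.continuous.bounded_above_of_compact_support hρc
  obtain ⟨C', hC'⟩ := (hρd.continuous_deriv le_rfl).bounded_above_of_compact_support hρc.deriv
  have huL' := huL
  have hGL' := hGL
  rw [restrict_cylinder] at huL' hGL'
  set μ : Measure ℝ := volume.restrict (Ioo 0 T) with hμ
  have hU : MemLp (fun z => u z - b) 2 (μ.prod (volume.restrict Ω)) := huL'.sub (memLp_const b)
  have hcs : ∀ t : ℝ, Continuous fun s : ℝ => t - s := fun t => continuous_const.sub continuous_id
  have hc1 : ∀ t, Continuous fun s => -ρ (t - s) := fun t => (hρ.continuous.comp (hcs t)).neg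
  have hc2 : ∀ t, Continuous fun s => -deriv ρ (t - s) := fun t =>
    ((hρd.continuous_deriv le_rfl).comp (hcs t)).neg
  have hCn : ∀ t s, |-ρ (t - s)| ≤ C := fun t s => by rw [abs_neg]; exact hC _
  have hCn' : ∀ t s, |-deriv ρ (t - s)| ≤ C' := fun t s => by rw [abs_neg]; exact hC' _
  have hslice : ∀ᵐ x ∂volume.restrict Ω, Integrable (fun s => u (s, x) - b) μ :=
    (hU.integrable (by norm_num)).prod_left_ae
  have hRd : ∀ t, HasDerivAt (fun t => ∫ s in (0 : ℝ)..t, ρ s) (ρ t) t := fun t =>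
    intervalIntegral.integral_hasDerivAt_right (hρ.continuous.intervalIntegrable _ _)
      (hρ.continuous.stronglyMeasurableAtFilter _ _) hρ.continuous.continuousAt
  have hρz : ∀ s, s ∉ Ioo 0 ε → ρ s = 0 := fun s hs =>
    image_eq_zero_of_notMem_tsupport fun h => hs (hρs h)
  have hR0 : ∀ t ≤ 0, ∫ s in (0 : ℝ)..t, ρ s = 0 := fun t ht => by
    rw [intervalIntegral.integral_symm, intervalIntegral.integral_of_le ht,
      setIntegral_eq_zero_of_forall_eq_zero, neg_zero]
    exact fun s hs => hρz s fun h => absurd h.1 (not_lt.2 hs.2)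
  have hRn : ∀ t ≥ 0, 0 ≤ ∫ s in (0 : ℝ)..t, ρ s := fun t ht =>
    intervalIntegral.integral_nonneg ht fun s _ => hρn s
  have hR1 : ∀ t ≥ ε, ∫ s in (0 : ℝ)..t, ρ s = 1 := fun t ht => by
    rw [intervalIntegral.integral_of_le (hε.le.trans ht),
      setIntegral_eq_integral_of_forall_compl_eq_zero, hρ1]
    exact fun s hs => hρz s fun h => hs ⟨h.1, h.2.le.trans ht⟩
  set c₀ := Real.exp (-(κ * A) - κ ^ 2 * T) with hc₀
  -- Since the barrier is caloric and `∫₀ᵗ ρ` has derivative `ρ`, this solves `∂ₜS - ΔS = b ρ(t)`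
  -- exactly. The delay by `ε` gives its sign: for `t < ε` the barrier is evaluated at a negative
  -- time and is nonpositive, and for `t ≥ ε` the integral is `1` and dominates it.
  set S : ℝ → Space N → ℝ := fun t x =>
    b * ((∫ s in (0 : ℝ)..t, ρ s) - barrier T A κ i₀ (t - ε) x) with hSdef
  set S' : ℝ → Space N → ℝ := fun t x =>
    b * (ρ t - c₀ * (Real.exp (κ * x i₀ + κ ^ 2 * (t - ε)) * κ ^ 2)) with hS'def
  have hSform : ∀ t, S t = fun x => (b * (∫ s in (0 : ℝ)..t, ρ s) + b * (c₀ * Real.exp (κ * A))) +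
      (-(b * (c₀ * Real.exp (κ ^ 2 * (t - ε))))) * Real.exp (κ * x i₀) := fun t => by
    funext x
    simp only [hSdef, barrier, Real.exp_add]
    ring
  have hS'cont : Continuous fun z : ℝ × Space N => S' z.1 z.2 := by
    have := hρ.continuous
    simp only [hS'def]
    fun_prop
  have hS0 : ∀ t < T, ∀ x ∈ Ω, 0 ≤ S t x := by
    intro t ht x hx
    refine mul_nonneg hb (sub_nonneg.2 ?_)
    rcases le_or_gt ε t with h | h
    · rw [hR1 t h]
      exact barrier_le_one hκ (by linarith) (hA x hx)
    · refine (barrier_nonpos hκ (by linarith) (hA x hx)).trans ?_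
      rcases le_or_gt t 0 with h' | h'
      · exact (hR0 t h').ge
      · exact hRn t h'.le
  obtain ⟨M, hM⟩ := ((isCompact_Icc (a := (-1 : ℝ)) (b := T)).prod
    hΩb.isCompact_closure).exists_bound_of_continuousOn hS'cont.continuousOn
  have main := ae_le_of_weak_subsolution hΩo hΩb (T := T)
    (p := fun t => timeAvg μ (fun s => -ρ (t - s)) fun z => u z - b)
    (q := fun t => timeAvg μ (fun s => -deriv ρ (t - s)) fun z => u z - b)
    (P := fun t => timeAvg μ (fun s => -ρ (t - s)) G) (c := fun t => b * ρ t)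
    (S := S) (S' := S') (B := fun x => ∫ s, C' * ‖u (s, x) - b‖ ∂μ) (M := M)
    (fun t _ => memW0_timeAvg (hc1 t) (hCn t) hU hGL' hW0)
    (fun t _ => memLp_timeAvg (hc2 t) (hCn' t) hU)
    (by
      filter_upwards [hslice] with x hx t
      have := hasDerivAt_timeAvg (k := fun s => -ρ s) (U := fun z => u z - b) (x := x)
        (C := C) (C' := C') hρd.neg
        (fun s => by rw [abs_neg]; exact hC s)
        (fun s => by rw [deriv.fun_neg, abs_neg]; exact hC' s) hx t
      simpa only [deriv.fun_neg] using this)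
    (by
      filter_upwards [hslice] with x hx t
      rw [timeAvg, ← Real.norm_eq_abs]
      refine (norm_integral_le_integral_norm _).trans ?_
      refine integral_mono_of_nonneg (Eventually.of_forall fun s => norm_nonneg _)
        (hx.norm.const_mul C') (Eventually.of_forall fun s => ?_)
      dsimp only
      rw [norm_smul]
      exact mul_le_mul_of_nonneg_right (hCn' t s) (norm_nonneg _))
    ((hU.integrable (by norm_num)).norm.const_mul C').integral_prod_right
    (fun t ht ψ hψ hψ0 => weak_timeAvg_le hΩb hT hf huL hGL hweak hρ hρc hρ0 hρn ht hψ hψ0)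
    (fun t => by
      rw [hSform]
      refine contDiff_const.add (contDiff_const.mul (Real.contDiff_exp.comp (contDiff_const.mul ?_)))
      exact (EuclideanSpace.proj i₀ : Space N →L[ℝ] ℝ).contDiff)
    hS0
    (fun t x => by
      have h1 : HasDerivAt (fun t : ℝ => κ * x i₀ + κ ^ 2 * (t - ε)) (κ ^ 2) t := by
        simpa using (((hasDerivAt_id t).sub_const ε).const_mul (κ ^ 2)).const_add (κ * x i₀)
      exact ((hRd t).sub ((h1.exp.sub_const _).const_mul c₀)).const_mul b)
    (fun t => hS'cont.comp (Continuous.prodMk_right t))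
    (fun t ht x hx => hM (t, x) ⟨⟨ht.1.le, ht.2.le⟩, subset_closure hx⟩)
    (fun t _ x _ => by
      rw [hSform t, lap_add_mul_exp_coord]
      simp only [hS'def, Real.exp_add]
      apply le_of_eq
      ring)
    (by
      refine (ae_restrict_iff' hΩo.measurableSet).2 (Eventually.of_forall fun x hx => ?_)
      refine le_trans (le_of_eq ?_) (hS0 0 hT x hx)
      -- At time `0` the average involves only `ρ(-s)` with `s > 0`, which vanishes. The mollified
      -- function starts from zero whatever the initial datum is.
      refine setIntegral_eq_zero_of_forall_eq_zero fun s hs => ?_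
      simp [hρz (-s) fun h => absurd h.1 (by linarith [hs.1])])
    (hε.le.trans hεt) ht
  filter_upwards [main, hslice] with x hx hxi
  have hkint : Integrable (fun s => ρ (t - s)) μ :=
    ((hρ.continuous.comp (hcs t)).integrableOn_Icc (a := 0) (b := T)).mono_set Ioo_subset_Icc_self
  have hxu : Integrable (fun s => u (s, x)) μ := by
    refine (hxi.add (integrable_const b)).congr (Eventually.of_forall fun s => ?_)
    simp
  have hmul : Integrable (fun s => ρ (t - s) * u (s, x)) μ := by
    refine hxu.bdd_mul (c := C) (hρ.continuous.comp (hcs t)).aestronglyMeasurable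
      (Eventually.of_forall fun s => hC _)
  -- For `t ≥ ε` the window `(t - ε, t)` lies in `(0, T)`, so the kernel has full mass there and the
  -- average of the constant `b` is `b`.
  have e : timeAvg μ (fun s => -ρ (t - s)) (fun z => u z - b) x =
      b - timeAvg μ (fun s => ρ (t - s)) u x := by
    have e1 : ∀ s, -ρ (t - s) • (u (s, x) - b) = b * ρ (t - s) - ρ (t - s) * u (s, x) := fun s => by
      rw [smul_eq_mul]; ring
    simp only [timeAvg, e1]
    rw [integral_sub (hkint.const_mul b) hmul, integral_const_mul,
      setIntegral_kernel_comp_sub hρs hρ1 hεt ht, mul_one]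
    rfl
  rw [e] at hx
  simp only [hSdef, hR1 t hεt] at hx
  linarith

/-- A continuous weak solution with lateral boundary value `b` and nonnegative initial value is
bounded below by `b` times the barrier. -/
theorem IsWeakSolution.mul_barrier_le {Ω : Set (Space N)} (hΩo : IsOpen Ω)
    (hΩb : Bornology.IsBounded Ω) {T : ℝ} (hT : 0 < T) {b : ℝ} (hb : 0 ≤ b) {f : Space N → ℝ}
    (hf : ∀ᵐ x ∂volume.restrict Ω, 0 ≤ f x) {u v : ℝ × Space N → ℝ}
    (hu : IsWeakSolution T Ω b f u) (hv : ContinuousOn v (cylinder T Ω))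
    (hvu : v =ᵐ[volume.restrict (cylinder T Ω)] u) {A κ : ℝ} {i₀ : Fin N} (hκ : 0 ≤ κ)
    (hA : ∀ x ∈ Ω, x i₀ ≤ A) {z : ℝ × Space N} (hz : z ∈ cylinder T Ω) :
    b * barrier T A κ i₀ z.1 z.2 ≤ v z := by
  obtain ⟨t, x₀⟩ := z
  obtain ⟨⟨ht0, htT⟩, hx₀⟩ : (0 < t ∧ t < T) ∧ x₀ ∈ Ω := hz
  have hQo : IsOpen (cylinder T Ω) := isOpen_Ioo.prod hΩo
  set μ : Measure ℝ := volume.restrict (Ioo 0 T) with hμ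
  have hbc := continuous_barrier T A κ i₀
  -- Widths of averaging windows that shrink to zero and do not reach before time `0`. Being
  -- countably many, they share one exceptional null set in `x`.
  have hε : ∀ k : ℕ, 0 < t / (k + 2) := fun k => by positivity
  have hεt : ∀ k : ℕ, t / (k + 2) ≤ t := fun k =>
    div_le_self ht0.le (by linarith [(Nat.cast_nonneg k : (0 : ℝ) ≤ k)])
  have hεlim : Tendsto (fun k : ℕ => t / ((k : ℝ) + 2)) atTop (𝓝 0) :=
    tendsto_const_nhds.div_atTop (tendsto_atTop_add_const_right _ _ tendsto_natCast_atTop_atTop)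
  choose ρ hρ hρc hρn hρs hρ1 using fun k : ℕ => exists_kernel (hε k)
  have h1 : ∀ᵐ x ∂volume.restrict Ω, ∀ k : ℕ, b * barrier T A κ i₀ (t - t / (k + 2)) x ≤
      timeAvg μ (fun s => ρ k (t - s)) u x := ae_all_iff.2 fun k =>
    hu.mul_barrier_le_timeAvg hΩo hΩb hT hb hf hκ hA (hε k) (hρ k) (hρc k) (hρn k) (hρs k)
      (hρ1 k) (hεt k) htT
  have h2 : ∀ᵐ x ∂volume.restrict Ω, ∀ᵐ s ∂μ, v (s, x) = u (s, x) := by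
    have : v =ᵐ[μ.prod (volume.restrict Ω)] u := by rwa [restrict_cylinder] at hvu
    have hsw : ∀ᵐ w ∂(volume.restrict Ω).prod μ, v w.swap = u w.swap :=
      Measure.measurePreserving_swap.quasiMeasurePreserving.ae this
    exact Measure.ae_ae_of_ae_prod hsw
  have : IsFiniteMeasure ((volume : Measure (Space N)).restrict Ω) :=
    ⟨by simpa using hΩb.measure_lt_top⟩
  have h4 : ∀ᵐ x ∂volume.restrict Ω, Integrable (fun s => u (s, x)) μ := by
    have huL := hu.1
    rw [restrict_cylinder] at huL
    exact (huL.integrable (by norm_num)).prod_left_ae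
  have h3 : ∀ᵐ x ∂volume.restrict Ω, b * barrier T A κ i₀ t x ≤ v (t, x) := by
    filter_upwards [h1, h2, h4, ae_restrict_mem hΩo.measurableSet] with x hx1 hx2 hx4 hxΩ
    have hcont : ContinuousAt (fun s => v (s, x)) t := by
      have : ContinuousAt v (t, x) := hv.continuousAt (hQo.mem_nhds ⟨⟨ht0, htT⟩, hxΩ⟩)
      exact ContinuousAt.comp (f := fun s : ℝ => (s, x)) this (by fun_prop)
    refine le_of_forall_pos_le_add fun δ hδ => ?_
    -- Once the window is shorter than `r`, the average of `u(·, x)` over it is at most `v(t, x) +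
    -- δ`, as the kernel is nonnegative with mass one.
    have hev : ∀ᶠ s in 𝓝 t, v (s, x) < v (t, x) + δ :=
      hcont.eventually_lt continuousAt_const (by linarith)
    obtain ⟨r, hr, hrs⟩ := Metric.eventually_nhds_iff.1 hev
    have hlim : Tendsto (fun k : ℕ => b * barrier T A κ i₀ (t - t / (k + 2)) x) atTop
        (𝓝 (b * barrier T A κ i₀ t x)) := by
      have hc : Continuous fun s => b * barrier T A κ i₀ (t - s) x :=
        continuous_const.mul (hbc.comp (f := fun s : ℝ => (t - s, x)) (by fun_prop))
      have := (hc.tendsto 0).comp hεlim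
      rwa [sub_zero] at this
    refine le_of_tendsto hlim ?_
    filter_upwards [hεlim.eventually (gt_mem_nhds hr)] with k hk
    refine (hx1 k).trans ?_
    have hmass := setIntegral_kernel_comp_sub (hρs k) (hρ1 k) (hεt k) htT
    have hkint : Integrable (fun s => ρ k (t - s)) μ :=
      (((hρ k).continuous.comp (continuous_const.sub continuous_id)).integrableOn_Icc
        (a := 0) (b := T)).mono_set Ioo_subset_Icc_self
    obtain ⟨C, hC⟩ := (hρ k).continuous.bounded_above_of_compact_support (hρc k)
    have hiu : Integrable (fun s => ρ k (t - s) • u (s, x)) μ :=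
      hx4.bdd_mul (c := C) hkint.1 (Eventually.of_forall fun s => hC _)
    have : timeAvg μ (fun s => ρ k (t - s)) u x ≤ ∫ s, (v (t, x) + δ) * ρ k (t - s) ∂μ := by
      refine integral_mono_ae hiu (hkint.const_mul _) ?_
      filter_upwards [hx2] with s hs
      rw [smul_eq_mul, ← hs, mul_comm]
      by_cases hts : t - s ∈ tsupport (ρ k)
      · refine mul_le_mul_of_nonneg_right (hrs ?_).le (hρn k _)
        have := hρs k hts
        rw [Real.dist_eq, abs_sub_lt_iff]
        constructor <;> linarith [this.1, this.2]
      · simp [image_eq_zero_of_notMem_tsupport hts]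
    rwa [integral_const_mul, hmass, mul_one] at this
  -- At the fixed time `t` the set where the bound fails is open, by continuity of `v` and of the
  -- barrier, and null, hence empty.
  set V := Ω ∩ (fun x => v (t, x) - b * barrier T A κ i₀ t x) ⁻¹' Iio 0 with hV
  have hVo : IsOpen V := by
    refine ContinuousOn.isOpen_inter_preimage ?_ hΩo isOpen_Iio
    refine ContinuousOn.sub ?_
      (continuous_const.mul (hbc.comp (Continuous.prodMk_right t))).continuousOn
    exact hv.comp (Continuous.prodMk_right t).continuousOn fun x hx => ⟨⟨ht0, htT⟩, hx⟩
  have hV0 : volume V = 0 := by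
    refine measure_mono_null ?_ ((ae_restrict_iff' hΩo.measurableSet).1 h3)
    rintro x ⟨hx, hx'⟩ hn
    have := hn hx
    have hx'' : v (t, x) - b * barrier T A κ i₀ t x < 0 := hx'
    linarith
  by_contra hlt
  have hmem : x₀ ∈ V := ⟨hx₀, by rw [not_le] at hlt; exact sub_neg.2 hlt⟩
  exact (hVo.measure_pos volume ⟨x₀, hmem⟩).ne' hV0

/-! ### Weak solutions are distributional solutions -/

theorem deriv_slice {φ : ℝ × Space N → ℝ} (hφ : ContDiff ℝ 1 φ) (z : ℝ × Space N) :
    deriv (fun s => φ (s, z.2)) z.1 = fderiv ℝ φ z (1, 0) := by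
  have h1 : HasFDerivAt φ (fderiv ℝ φ z) z := (hφ.differentiable one_ne_zero z).hasFDerivAt
  have h2 : HasDerivAt (fun s : ℝ => (s, z.2)) (1, 0) z.1 :=
    (hasDerivAt_id z.1).prodMk (hasDerivAt_const z.1 z.2)
  exact (h1.comp_hasDerivAt z.1 h2).deriv

theorem fderiv_slice {φ : ℝ × Space N → ℝ} (hφ : ContDiff ℝ 1 φ) (s : ℝ) (x : Space N) :
    fderiv ℝ (fun y => φ (s, y)) x =
      (fderiv ℝ φ (s, x)).comp (ContinuousLinearMap.inr ℝ ℝ (Space N)) := by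
  have h1 : HasFDerivAt φ (fderiv ℝ φ (s, x)) (s, x) :=
    (hφ.differentiable one_ne_zero (s, x)).hasFDerivAt
  exact (h1.comp x (hasFDerivAt_prodMk_right s x)).fderiv

/-- Writing the Laplacian of a slice through derivatives of `φ` on the product space makes its joint
continuity in `(s, x)` visible. -/
theorem lap_slice {φ : ℝ × Space N → ℝ} (hφ : ContDiff ℝ 2 φ) (s : ℝ) (x : Space N) :
    lap (fun y => φ (s, y)) x =
      ∑ i, fderiv ℝ (fun w => fderiv ℝ φ w (0, stdVec i)) (s, x) (0, stdVec i) := by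
  refine Finset.sum_congr rfl fun i _ => ?_
  have h1 : (fun y => fderiv ℝ (fun y => φ (s, y)) y (stdVec i)) =
      fun y => (fun w => fderiv ℝ φ w (0, stdVec i)) (s, y) := by
    funext y
    rw [fderiv_slice (hφ.of_le (by norm_num))]
    simp
  rw [h1, fderiv_slice (contDiff_fderiv_apply hφ (by norm_num) _)]
  simp

theorem continuous_lap_slice {φ : ℝ × Space N → ℝ} (hφ : ContDiff ℝ 2 φ) :
    Continuous fun z : ℝ × Space N => lap (fun y => φ (z.1, y)) z.2 := by
  simp only [lap_slice hφ]
  refine continuous_finsetSum _ fun i _ => ?_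
  exact (contDiff_fderiv_apply (m := 0)
    (contDiff_fderiv_apply (m := 1) hφ (by norm_num) _) (by norm_num) _).continuous

theorem continuous_gradient_slice {φ : ℝ × Space N → ℝ} (hφ : ContDiff ℝ 1 φ) :
    Continuous fun z : ℝ × Space N => gradient (fun y => φ (z.1, y)) z.2 := by
  simp only [gradient, fderiv_slice hφ]
  exact (InnerProductSpace.toDual ℝ (Space N)).symm.continuous.comp
    ((hφ.continuous_fderiv one_ne_zero).clm_comp continuous_const)

theorem tsupport_slice_subset {φ : ℝ × Space N → ℝ} (s : ℝ) :
    tsupport (fun y => φ (s, y)) ⊆ (fun y => (s, y)) ⁻¹' tsupport φ :=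
  closure_minimal (fun _ hy => subset_tsupport φ hy)
    ((isClosed_tsupport φ).preimage (Continuous.prodMk_right s))

theorem hasCompactSupport_of_slice {F : Type*} [Zero F] {φ : ℝ × Space N → ℝ}
    (hφ : HasCompactSupport φ) {D : ℝ × Space N → F}
    (hD : ∀ z : ℝ × Space N, z.2 ∉ tsupport (fun y => φ (z.1, y)) → D z = 0) :
    HasCompactSupport D := by
  refine HasCompactSupport.intro hφ.isCompact fun z hz => hD z fun h => hz ?_
  exact tsupport_slice_subset z.1 h

theorem IsTest.slice {T : ℝ} {Ω : Set (Space N)} {φ : ℝ × Space N → ℝ}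
    (hφ : IsTest (cylinder T Ω) φ) (s : ℝ) : IsTest Ω fun y => φ (s, y) := by
  refine ⟨hφ.1.comp (contDiff_prodMk_right s), ?_, ?_⟩
  · refine (hφ.2.1.isCompact.image continuous_snd).of_isClosed_subset (isClosed_tsupport _) ?_
    exact fun y hy => ⟨(s, y), tsupport_slice_subset s hy, rfl⟩
  · exact fun y hy => (hφ.2.2 (tsupport_slice_subset s hy)).2

/-- The support of `φ` avoids time `0`, so the initial datum drops out. On almost every time slice
`u - b` lies in `W_0^{1,2}`, so the gradient can be moved onto `φ`, and the constant `b` contributes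
nothing because the Laplacian of a test function has integral zero. -/
theorem IsWeakSolution.setIntegral_mul_heat_eq_zero {T : ℝ} {Ω : Set (Space N)}
    (hΩb : Bornology.IsBounded Ω) {b : ℝ} {f : Space N → ℝ}
    {u : ℝ × Space N → ℝ} (hu : IsWeakSolution T Ω b f u) {φ : ℝ × Space N → ℝ}
    (hφ : IsTest (cylinder T Ω) φ) :
    ∫ z in cylinder T Ω,
      u z * (deriv (fun s => φ (s, z.2)) z.1 + lap (fun y => φ (z.1, y)) z.2) = 0 := by
  obtain ⟨huL, G, hGL, hW0, hweak⟩ := hu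
  have : IsFiniteMeasure ((volume : Measure (Space N)).restrict Ω) :=
    ⟨by simpa using hΩb.measure_lt_top⟩
  have hφ1 : ContDiff ℝ 1 φ := contDiff_infty.1 hφ.1 1
  have hφ2 : ContDiff ℝ 2 φ := contDiff_infty.1 hφ.1 2
  have hw := hweak φ ⟨hφ.1, hφ.2.1, hφ.2.2.trans (prod_mono (fun s hs => hs.2) subset_rfl)⟩
  have hz : ∀ x, φ (0, x) = 0 := fun x => image_eq_zero_of_notMem_tsupport fun h =>
    lt_irrefl _ (hφ.2.2 h).1.1
  simp only [hz, mul_zero, integral_zero] at hw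
  rw [restrict_cylinder] at huL hGL hw ⊢
  set π := (volume.restrict (Ioo 0 T)).prod ((volume : Measure (Space N)).restrict Ω) with hπ
  have hπr : π = volume.restrict (cylinder T Ω) := (restrict_cylinder T Ω).symm
  have : IsFiniteMeasureOnCompacts π := by rw [hπr]; infer_instance
  have hDt : MemLp (fun z : ℝ × Space N => deriv (fun s => φ (s, z.2)) z.1) 2 π := by
    simp only [deriv_slice hφ1]
    exact (contDiff_fderiv_apply (m := 0) hφ1 (by norm_num) _).continuous.memLp_of_hasCompactSupport
      (hφ.2.1.fderiv_apply ℝ _)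
  have hDg : MemLp (fun z : ℝ × Space N => gradient (fun y => φ (z.1, y)) z.2) 2 π := by
    refine (continuous_gradient_slice hφ1).memLp_of_hasCompactSupport
      (hasCompactSupport_of_slice hφ.2.1 fun z hz => ?_)
    simp [gradient, (notMem_tsupport_iff_eventuallyEq.1 hz).fderiv_eq]
  have hDl : MemLp (fun z : ℝ × Space N => lap (fun y => φ (z.1, y)) z.2) 2 π :=
    (continuous_lap_slice hφ2).memLp_of_hasCompactSupport
      (hasCompactSupport_of_slice hφ.2.1 fun z hz => lap_eq_zero_of_notMem_tsupport hz)
  have i1 : Integrable (fun z : ℝ × Space N => u z * deriv (fun s => φ (s, z.2)) z.1) π :=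
    huL.integrable_mul hDt
  have i2 := integrable_inner_of_memLp hGL hDg
  have i3 : Integrable (fun z : ℝ × Space N => u z * lap (fun y => φ (z.1, y)) z.2) π :=
    huL.integrable_mul hDl
  have key : ∫ z, inner ℝ (G z) (gradient (fun y => φ (z.1, y)) z.2) ∂π =
      -∫ z, u z * lap (fun y => φ (z.1, y)) z.2 ∂π := by
    rw [hπ, integral_prod _ i2, integral_prod _ i3, ← integral_neg]
    refine integral_congr_ae ?_
    filter_upwards [hW0, i3.prod_right_ae] with s hs hs3
    have ht : IsTest Ω fun y => φ (s, y) := hφ.slice s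
    have e1 := hs.setIntegral_inner_gradient ht
    have hl0 : ∫ x in Ω, lap (fun y => φ (s, y)) x = 0 := by
      rw [setIntegral_eq_integral_of_forall_compl_eq_zero fun x hx => ht.lap_eq_zero hx]
      exact integral_lap_eq_zero (ht.contDiff 2) ht.2.1
    have hli : Integrable (lap fun y => φ (s, y)) (volume.restrict Ω) :=
      ((continuous_lap (ht.contDiff 2)).integrable_of_hasCompactSupport
        (hasCompactSupport_lap ht.2.1)).integrableOn
    rw [e1]
    simp only [sub_mul]
    rw [integral_sub hs3 (hli.const_mul b), integral_const_mul, hl0, mul_zero, sub_zero]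
  have i1n : Integrable (fun z : ℝ × Space N => -(u z * deriv (fun s => φ (s, z.2)) z.1)) π := i1.neg
  rw [integral_add i1n i2, key, integral_neg] at hw
  simp only [mul_add]
  rw [integral_add i1 i3]
  linarith

/-! ### The heat kernel -/

/-- The heat kernel `(4πτ)^{-N/2} exp(-‖ξ‖²/(4τ))`, for `τ > 0`. -/
def heatKernel (τ : ℝ) (ξ : Space N) : ℝ :=
  Real.exp (-(N / 2 : ℝ) * Real.log (4 * Real.pi * τ) - (4 * τ)⁻¹ * ‖ξ‖ ^ 2)

theorem heatKernel_pos (τ : ℝ) (ξ : Space N) : 0 < heatKernel τ ξ := Real.exp_pos _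

theorem contDiffAt_heatKernel {z : ℝ × Space N} (hz : 0 < z.1) {n : WithTop ℕ∞} :
    ContDiffAt ℝ n (fun z : ℝ × Space N => heatKernel z.1 z.2) z := by
  unfold heatKernel
  have h1 : ContDiffAt ℝ n (fun z : ℝ × Space N => 4 * Real.pi * z.1) z :=
    contDiffAt_const.mul contDiffAt_fst
  have h2 : ContDiffAt ℝ n (fun z : ℝ × Space N => 4 * z.1) z :=
    contDiffAt_const.mul contDiffAt_fst
  refine ContDiffAt.exp ((contDiffAt_const.mul (h1.log ?_)).sub ((h2.inv ?_).mul ?_))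
  · have := Real.pi_pos
    positivity
  · positivity
  · exact contDiffAt_snd.norm_sq ℝ

/-- Regularity of the kernel is used only at positive times. A factor vanishing before `ε` takes
care of the rest of the space. -/
theorem contDiff_mul_heatKernel {a : ℝ × Space N → ℝ} {n : WithTop ℕ∞} (ha : ContDiff ℝ n a)
    {ε : ℝ} (hε : 0 < ε) (h0 : ∀ z : ℝ × Space N, z.1 < ε → a z = 0) :
    ContDiff ℝ n (fun z : ℝ × Space N => a z * heatKernel z.1 z.2) := by
  refine contDiff_iff_contDiffAt.2 fun z => ?_
  rcases lt_or_ge z.1 ε with h | h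
  · refine (contDiffAt_const (c := (0 : ℝ))).congr_of_eventuallyEq ?_
    filter_upwards [(isOpen_Iio.preimage continuous_fst).mem_nhds h] with w hw
    rw [h0 w hw, zero_mul]
  · exact ha.contDiffAt.mul (contDiffAt_heatKernel (hε.trans_le h))

theorem hasDerivAt_heatKernel {τ : ℝ} (hτ : 0 < τ) (ξ : Space N) :
    HasDerivAt (fun τ => heatKernel τ ξ)
      ((-(N / 2 : ℝ) * τ⁻¹ + (4 * τ ^ 2)⁻¹ * ‖ξ‖ ^ 2) * heatKernel τ ξ) τ := by
  have hπ := Real.pi_pos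
  have h1 : HasDerivAt (fun τ : ℝ => 4 * Real.pi * τ) (4 * Real.pi) τ := by
    simpa using (hasDerivAt_id τ).const_mul (4 * Real.pi)
  have h2 : HasDerivAt (fun τ : ℝ => 4 * τ) 4 τ := by
    simpa using (hasDerivAt_id τ).const_mul (4 : ℝ)
  have := (((h1.log (by positivity)).const_mul (-(N / 2 : ℝ))).sub
    ((h2.inv (by positivity)).mul_const (‖ξ‖ ^ 2))).exp
  refine this.congr_deriv ?_
  simp only [heatKernel, Pi.inv_apply]
  rw [mul_comm]
  congr 1
  field_simp
  ring

theorem stdVec_apply_sum (ξ : Space N) : ∑ i, ξ i • (stdVec i : Space N) = ξ := by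
  have := (EuclideanSpace.basisFun (Fin N) ℝ).sum_repr ξ
  simpa [stdVec] using this

theorem inner_stdVec (ξ : Space N) (i : Fin N) : inner ℝ ξ (stdVec i) = ξ i := by
  simp [stdVec, EuclideanSpace.inner_single_right]

/-- The Laplacian of the product of a smooth function and a Gaussian. -/
theorem lap_mul_gaussian {η : Space N → ℝ} (hη : ContDiff ℝ 2 η) (c a : ℝ) (ξ : Space N) :
    lap (fun ξ => η ξ * Real.exp (c - a * ‖ξ‖ ^ 2)) ξ =
      (lap η ξ - 4 * a * fderiv ℝ η ξ ξ + (4 * a ^ 2 * ‖ξ‖ ^ 2 - 2 * a * N) * η ξ) *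
        Real.exp (c - a * ‖ξ‖ ^ 2) := by
  have hg : ∀ x : Space N, HasFDerivAt (fun ξ : Space N => Real.exp (c - a * ‖ξ‖ ^ 2))
      ((-(2 * a) * Real.exp (c - a * ‖x‖ ^ 2)) • innerSL ℝ x) x := fun x => by
    have h1 : HasFDerivAt (fun ξ : Space N => ‖ξ‖ ^ 2) (2 • innerSL ℝ x) x :=
      (hasStrictFDerivAt_norm_sq x).hasFDerivAt
    refine ((h1.const_mul a).const_sub c).exp.congr_fderiv ?_
    ext v
    simp
    ring
  have hη1 : ∀ x, HasFDerivAt η (fderiv ℝ η x) x := fun x =>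
    (hη.differentiable (by norm_num) x).hasFDerivAt
  have hηi : ∀ i : Fin N, ∀ x, HasFDerivAt (fun y => fderiv ℝ η y (stdVec i))
      (fderiv ℝ (fun y => fderiv ℝ η y (stdVec i)) x) x := fun i x =>
    ((contDiff_fderiv_apply (m := 1) hη (by norm_num) (stdVec i)).differentiable
      one_ne_zero x).hasFDerivAt
  have hco : ∀ i : Fin N, ∀ x : Space N, HasFDerivAt (fun x : Space N => x i)
      (EuclideanSpace.proj i : Space N →L[ℝ] ℝ) x := fun i x =>
    (EuclideanSpace.proj i : Space N →L[ℝ] ℝ).hasFDerivAt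
  have e1 : ∀ i : Fin N, (fun y => fderiv ℝ
      (fun ξ => η ξ * Real.exp (c - a * ‖ξ‖ ^ 2)) y (stdVec i)) =
      fun y => (fderiv ℝ η y (stdVec i) - 2 * a * (y i * η y)) *
        Real.exp (c - a * ‖y‖ ^ 2) := by
    intro i
    funext y
    rw [((hη1 y).fun_mul (hg y)).fderiv]
    simp [inner_stdVec]
    ring
  simp only [lap, e1]
  have e2 : ∀ i : Fin N, fderiv ℝ (fun y => (fderiv ℝ η y (stdVec i) - 2 * a * (y i * η y)) *
        Real.exp (c - a * ‖y‖ ^ 2)) ξ (stdVec i) =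
      (fderiv ℝ (fun y => fderiv ℝ η y (stdVec i)) ξ (stdVec i) -
        4 * a * (ξ i * fderiv ℝ η ξ (stdVec i)) +
        (4 * a ^ 2 * (ξ i) ^ 2 - 2 * a) * η ξ) * Real.exp (c - a * ‖ξ‖ ^ 2) := by
    intro i
    rw [(((hηi i ξ).fun_sub (((hco i ξ).fun_mul (hη1 ξ)).const_mul (2 * a))).fun_mul (hg ξ)).fderiv]
    have : (stdVec i : Space N) i = 1 := by simp [stdVec]
    simp [inner_stdVec, this]
    ring
  simp only [e2]
  rw [← Finset.sum_mul, Finset.sum_add_distrib, Finset.sum_sub_distrib, ← Finset.sum_mul,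
    ← Finset.mul_sum, Finset.sum_sub_distrib, ← Finset.mul_sum]
  have s1 : ∑ i, ξ i * fderiv ℝ η ξ (stdVec i) = fderiv ℝ η ξ ξ := by
    have := congrArg (fderiv ℝ η ξ) (stdVec_apply_sum ξ)
    rw [map_sum] at this
    simpa only [map_smul, smul_eq_mul] using this
  have s2 : ∑ i, (ξ i) ^ 2 = ‖ξ‖ ^ 2 := (EuclideanSpace.real_norm_sq_eq ξ).symm
  rw [s1, s2, Finset.sum_const, Finset.card_univ, Fintype.card_fin, nsmul_eq_mul]
  ring

/-! ### A localized fundamental solution -/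

/-- A smooth function vanishing for `τ ≤ ε` and equal to `1` for `τ ≥ 2ε`. -/
def timeOn (ε τ : ℝ) : ℝ := Real.smoothTransition (ε⁻¹ * τ - 1)

/-- A smooth function equal to `1` for `τ ≤ r / 2` and vanishing for `τ ≥ r`. -/
def timeCut (r τ : ℝ) : ℝ := 1 - Real.smoothTransition (2 * r⁻¹ * τ - 1)

theorem contDiff_timeOn (ε : ℝ) : ContDiff ℝ ∞ (timeOn ε) :=
  contDiff_smoothTransition.comp ((contDiff_const.mul contDiff_id).sub contDiff_const)

theorem contDiff_timeCut (r : ℝ) : ContDiff ℝ ∞ (timeCut r) :=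
  contDiff_const.sub
    (contDiff_smoothTransition.comp ((contDiff_const.mul contDiff_id).sub contDiff_const))

theorem timeOn_eq_zero {ε τ : ℝ} (hε : 0 < ε) (h : τ ≤ ε) : timeOn ε τ = 0 :=
  Real.smoothTransition.zero_of_nonpos (by
    have : ε⁻¹ * τ ≤ ε⁻¹ * ε := by gcongr
    rw [inv_mul_cancel₀ hε.ne'] at this
    linarith)

theorem timeOn_eq_one {ε τ : ℝ} (hε : 0 < ε) (h : 2 * ε ≤ τ) : timeOn ε τ = 1 :=
  Real.smoothTransition.one_of_one_le (by
    have : ε⁻¹ * (2 * ε) ≤ ε⁻¹ * τ := by gcongr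
    rw [mul_left_comm, inv_mul_cancel₀ hε.ne'] at this
    linarith)

theorem timeOn_nonneg (ε τ : ℝ) : 0 ≤ timeOn ε τ := Real.smoothTransition.nonneg _

theorem timeOn_le_one (ε τ : ℝ) : timeOn ε τ ≤ 1 := Real.smoothTransition.le_one _

theorem timeCut_nonneg (r τ : ℝ) : 0 ≤ timeCut r τ := sub_nonneg.2 (Real.smoothTransition.le_one _)

theorem timeCut_le_one (r τ : ℝ) : timeCut r τ ≤ 1 :=
  sub_le_self _ (Real.smoothTransition.nonneg _)

theorem timeCut_eq_one {r τ : ℝ} (hr : 0 < r) (h : τ ≤ r / 2) : timeCut r τ = 1 := by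
  rw [timeCut, Real.smoothTransition.zero_of_nonpos, sub_zero]
  have : 2 * r⁻¹ * τ ≤ 2 * r⁻¹ * (r / 2) := by gcongr
  have h2 : 2 * r⁻¹ * (r / 2) = 1 := by field_simp
  linarith

theorem timeCut_eq_zero {r τ : ℝ} (hr : 0 < r) (h : r ≤ τ) : timeCut r τ = 0 := by
  rw [timeCut, Real.smoothTransition.one_of_one_le, sub_self]
  have : 2 * r⁻¹ * r ≤ 2 * r⁻¹ * τ := by gcongr
  have h2 : 2 * r⁻¹ * r = 2 := by field_simp
  linarith

theorem deriv_timeOn_nonneg {ε : ℝ} (hε : 0 < ε) (τ : ℝ) : 0 ≤ deriv (timeOn ε) τ := by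
  refine Monotone.deriv_nonneg fun a b hab => Real.smoothTransition.monotone ?_
  gcongr

theorem deriv_timeOn_of_lt {ε τ : ℝ} (hε : 0 < ε) (h : τ < ε) : deriv (timeOn ε) τ = 0 := by
  have : timeOn ε =ᶠ[𝓝 τ] fun _ => (0 : ℝ) := by
    filter_upwards [Iio_mem_nhds h] with s hs using timeOn_eq_zero hε (le_of_lt hs)
  rw [this.deriv_eq, deriv_const]

theorem deriv_timeOn_of_gt {ε τ : ℝ} (hε : 0 < ε) (h : 2 * ε < τ) : deriv (timeOn ε) τ = 0 := by
  have : timeOn ε =ᶠ[𝓝 τ] fun _ => (1 : ℝ) := by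
    filter_upwards [Ioi_mem_nhds h] with s hs using timeOn_eq_one hε (le_of_lt hs)
  rw [this.deriv_eq, deriv_const]

theorem deriv_timeCut_of_lt {r τ : ℝ} (hr : 0 < r) (h : τ < r / 2) : deriv (timeCut r) τ = 0 := by
  have : timeCut r =ᶠ[𝓝 τ] fun _ => (1 : ℝ) := by
    filter_upwards [Iio_mem_nhds h] with s hs using timeCut_eq_one hr (le_of_lt hs)
  rw [this.deriv_eq, deriv_const]

theorem deriv_timeCut_of_gt {r τ : ℝ} (hr : 0 < r) (h : r < τ) : deriv (timeCut r) τ = 0 := by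
  have : timeCut r =ᶠ[𝓝 τ] fun _ => (0 : ℝ) := by
    filter_upwards [Ioi_mem_nhds h] with s hs using timeCut_eq_zero hr (le_of_lt hs)
  rw [this.deriv_eq, deriv_const]

theorem continuous_deriv_timeOn (ε : ℝ) : Continuous (deriv (timeOn ε)) :=
  (contDiff_timeOn ε).continuous_deriv (by simp)

theorem continuous_deriv_timeCut (r : ℝ) : Continuous (deriv (timeCut r)) :=
  (contDiff_timeCut r).continuous_deriv (by simp)

/-- The heat kernel cut off in space by `η` and in time to `[ε, r]`. -/
def parametrix (ε r : ℝ) (η : Space N → ℝ) (z : ℝ × Space N) : ℝ :=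
  timeOn ε z.1 * timeCut r z.1 * η z.2 * heatKernel z.1 z.2

/-- The part of `(∂ₜ - Δ) parametrix` that concentrates at the origin. -/
def peak (ε r : ℝ) (η : Space N → ℝ) (z : ℝ × Space N) : ℝ :=
  deriv (timeOn ε) z.1 * timeCut r z.1 * η z.2 * heatKernel z.1 z.2

/-- The part of `(∂ₜ - Δ) parametrix` that stays bounded. -/
def remainder (r : ℝ) (η : Space N → ℝ) (z : ℝ × Space N) : ℝ :=
  if 0 < z.1 then
    (deriv (timeCut r) z.1 * η z.2 -
      timeCut r z.1 * (lap η z.2 - z.1⁻¹ * fderiv ℝ η z.2 z.2)) * heatKernel z.1 z.2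
  else 0

theorem lap_const_mul {η : Space N → ℝ} (hη : ContDiff ℝ 2 η) (A : ℝ) (x : Space N) :
    lap (fun y => A * η y) x = A * lap η x := by
  rw [lap, lap, Finset.mul_sum]
  refine Finset.sum_congr rfl fun i _ => ?_
  have h1 : (fun y => fderiv ℝ (fun y => A * η y) y (stdVec i)) =
      fun y => A * fderiv ℝ η y (stdVec i) := by
    funext y
    rw [fderiv_const_mul (hη.differentiable (by norm_num) y)]
    simp
  have h2 : ContDiff ℝ 1 fun y => fderiv ℝ η y (stdVec i) :=
    contDiff_fderiv_apply hη (by norm_num) _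
  rw [h1, fderiv_const_mul (h2.differentiable one_ne_zero x)]
  simp

theorem lap_comp_const_sub {f : Space N → ℝ} (hf : ContDiff ℝ 2 f) (x y : Space N) :
    lap (fun y => f (x - y)) y = lap f (x - y) := by
  refine Finset.sum_congr rfl fun i _ => ?_
  have h : ∀ (g : Space N → ℝ) (y : Space N), DifferentiableAt ℝ g (x - y) →
      fderiv ℝ (fun y => g (x - y)) y (stdVec i) = -fderiv ℝ g (x - y) (stdVec i) := by
    intro g y hg
    have e : fderiv ℝ (fun y => g (x - y)) y = _ :=
      (hg.hasFDerivAt.comp y ((hasFDerivAt_id y).const_sub x)).fderiv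
    rw [e]
    simp
  have h1 : (fun y => fderiv ℝ (fun y => f (x - y)) y (stdVec i)) =
      fun y => -fderiv ℝ f (x - y) (stdVec i) := by
    funext y
    exact h f y (hf.differentiable (by norm_num) _)
  have h2 : ContDiff ℝ 1 fun y => fderiv ℝ f y (stdVec i) :=
    contDiff_fderiv_apply hf (by norm_num) _
  rw [h1, fderiv_fun_neg, neg_apply,
    h (fun y => fderiv ℝ f y (stdVec i)) y (h2.differentiable one_ne_zero _), neg_neg]

/-- With `a = (4τ)⁻¹` in `lap_mul_gaussian`, the terms in which no cutoff is differentiated cancel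
against the time derivative of the kernel; this is the heat equation. The derivative of `timeOn`
gives the peak; those of `timeCut` and `η` give the remainder, still multiplied by `timeOn`. -/
theorem heat_parametrix {ε : ℝ} (hε : 0 < ε) (r : ℝ) {η : Space N → ℝ} (hη : ContDiff ℝ ∞ η)
    (z : ℝ × Space N) :
    deriv (fun τ => parametrix ε r η (τ, z.2)) z.1 - lap (fun ξ => parametrix ε r η (z.1, ξ)) z.2 =
      peak ε r η z + timeOn ε z.1 * remainder r η z := by
  obtain ⟨τ, ξ⟩ := z
  dsimp only
  rcases lt_or_ge τ ε with h | h
  · have h1 : (fun τ => parametrix ε r η (τ, ξ)) =ᶠ[𝓝 τ] fun _ => (0 : ℝ) := by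
      filter_upwards [Iio_mem_nhds h] with s hs
      simp [parametrix, timeOn_eq_zero hε (le_of_lt hs)]
    have h2 : (fun ξ => parametrix ε r η (τ, ξ)) = fun _ => (0 : ℝ) := by
      funext y
      simp [parametrix, timeOn_eq_zero hε h.le]
    rw [h1.deriv_eq, h2]
    simp [lap, peak, timeOn_eq_zero hε h.le, deriv_timeOn_of_lt hε h]
  · have hτ : 0 < τ := hε.trans_le h
    have hη2 : ContDiff ℝ 2 η := contDiff_infty.1 hη 2
    have d1 : HasDerivAt (timeOn ε) (deriv (timeOn ε) τ) τ :=
      ((contDiff_timeOn ε).differentiable (by simp) τ).hasDerivAt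
    have d2 : HasDerivAt (timeCut r) (deriv (timeCut r) τ) τ :=
      ((contDiff_timeCut r).differentiable (by simp) τ).hasDerivAt
    have d3 := (((d1.fun_mul d2).mul_const (η ξ)).fun_mul (hasDerivAt_heatKernel hτ ξ)).deriv
    have hl : lap (fun ξ => parametrix ε r η (τ, ξ)) ξ =
        (timeOn ε τ * timeCut r τ) * (lap η ξ - 4 * (4 * τ)⁻¹ * fderiv ℝ η ξ ξ +
          (4 * (4 * τ)⁻¹ ^ 2 * ‖ξ‖ ^ 2 - 2 * (4 * τ)⁻¹ * N) * η ξ) * heatKernel τ ξ := by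
      have := lap_mul_gaussian (η := fun ξ => (timeOn ε τ * timeCut r τ) * η ξ)
        (contDiff_const.mul hη2) (-(N / 2 : ℝ) * Real.log (4 * Real.pi * τ)) (4 * τ)⁻¹ ξ
      rw [lap_const_mul hη2, fderiv_const_mul (hη2.differentiable (by norm_num) ξ)] at this
      simp only [parametrix, heatKernel]
      rw [this]
      simp
      ring
    rw [hl]
    simp only [parametrix, peak, remainder, if_pos hτ]
    rw [d3]
    field_simp
    ring

theorem contDiff_parametrix {ε : ℝ} (hε : 0 < ε) (r : ℝ) {η : Space N → ℝ} (hη : ContDiff ℝ ∞ η) :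
    ContDiff ℝ ∞ (parametrix ε r η) := by
  refine contDiff_mul_heatKernel (a := fun z => timeOn ε z.1 * timeCut r z.1 * η z.2) ?_ hε ?_
  · exact (((contDiff_timeOn ε).comp contDiff_fst).mul ((contDiff_timeCut r).comp contDiff_fst)).mul
      (hη.comp contDiff_snd)
  · intro z hz
    simp [timeOn_eq_zero hε hz.le]

theorem continuous_peak {ε : ℝ} (hε : 0 < ε) (r : ℝ) {η : Space N → ℝ} (hη : Continuous η) :
    Continuous (peak ε r η) := by
  have := contDiff_mul_heatKernel (n := 0)
    (a := fun z : ℝ × Space N => deriv (timeOn ε) z.1 * timeCut r z.1 * η z.2) ?_ hε ?_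
  · exact this.continuous
  · have h1 := continuous_deriv_timeOn ε
    have h2 := (contDiff_timeCut r).continuous
    rw [contDiff_zero]
    fun_prop
  · intro z hz
    simp [deriv_timeOn_of_lt hε hz]

/-- The parametrix based at `z` as a function of its other argument is a test function if the
parabolic neighbourhood of `z` of size `r` lies in the cylinder. -/
theorem isTest_parametrix {T : ℝ} {Ω : Set (Space N)} {ε r : ℝ} (hε : 0 < ε) (hr : 0 < r)
    {η : Space N → ℝ} (hη : ContDiff ℝ ∞ η) (hη0 : ∀ ξ, r ≤ ‖ξ‖ → η ξ = 0) {z : ℝ × Space N}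
    (hz1 : r < z.1) (hz2 : z.1 < T) (hz3 : Metric.closedBall z.2 r ⊆ Ω) :
    IsTest (cylinder T Ω) (fun w => parametrix ε r η (z - w)) := by
  have hK : IsCompact (Icc (z.1 - r) z.1 ×ˢ Metric.closedBall z.2 r) :=
    isCompact_Icc.prod (isCompact_closedBall _ _)
  have hsub : tsupport (fun w => parametrix ε r η (z - w)) ⊆
      Icc (z.1 - r) z.1 ×ˢ Metric.closedBall z.2 r := by
    refine closure_minimal (fun w hw => ?_) hK.isClosed
    have hw' : timeOn ε (z.1 - w.1) * timeCut r (z.1 - w.1) * η (z.2 - w.2) *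
      heatKernel (z.1 - w.1) (z.2 - w.2) ≠ 0 := hw
    have h1 := left_ne_zero_of_mul hw'
    have h2 := left_ne_zero_of_mul h1
    refine ⟨⟨?_, ?_⟩, ?_⟩
    · by_contra hlt
      exact right_ne_zero_of_mul h2 (timeCut_eq_zero hr (by linarith))
    · by_contra hlt
      exact left_ne_zero_of_mul h2 (timeOn_eq_zero hε (by linarith))
    · by_contra hlt
      rw [Metric.mem_closedBall, dist_comm, dist_eq_norm, not_le] at hlt
      exact right_ne_zero_of_mul h1 (hη0 _ hlt.le)
  refine ⟨(contDiff_parametrix hε r hη).comp (contDiff_const.sub contDiff_id),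
    hK.of_isClosed_subset (isClosed_tsupport _) hsub, hsub.trans (prod_mono ?_ hz3)⟩
  exact fun s hs => ⟨by linarith [hs.1], by linarith [hs.2]⟩

/-- The distributional equation is tested with `w ↦ parametrix (z - w)`. The reflection reverses the
sign of the time derivative and preserves the Laplacian, so the adjoint operator `∂ₜ + Δ` acting in
`w` becomes `-(∂ₜ - Δ)` acting on the parametrix. -/
theorem IsWeakSolution.setIntegral_mul_peak_add_remainder {T : ℝ} {Ω : Set (Space N)}
    (hΩb : Bornology.IsBounded Ω) {b : ℝ} {f : Space N → ℝ}
    {u : ℝ × Space N → ℝ} (hu : IsWeakSolution T Ω b f u) {ε r : ℝ} (hε : 0 < ε) (hr : 0 < r)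
    {η : Space N → ℝ} (hη : ContDiff ℝ ∞ η) (hη0 : ∀ ξ, r ≤ ‖ξ‖ → η ξ = 0) {z : ℝ × Space N}
    (hz1 : r < z.1) (hz2 : z.1 < T) (hz3 : Metric.closedBall z.2 r ⊆ Ω) :
    ∫ w in cylinder T Ω, u w * (peak ε r η (z - w) +
      timeOn ε (z - w).1 * remainder r η (z - w)) = 0 := by
  have h := hu.setIntegral_mul_heat_eq_zero hΩb (isTest_parametrix hε hr hη hη0 hz1 hz2 hz3)
  rw [← neg_eq_zero, ← integral_neg, ← h]
  congr 1
  funext w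
  rw [← heat_parametrix hε r hη]
  have e1 : deriv (fun s => parametrix ε r η (z - (s, w.2))) w.1 =
      -deriv (fun τ => parametrix ε r η (τ, (z - w).2)) (z - w).1 :=
    deriv_comp_const_sub (f := fun τ => parametrix ε r η (τ, (z - w).2)) z.1 w.1
  have e2 : lap (fun y => parametrix ε r η (z - (w.1, y))) w.2 =
      lap (fun ξ => parametrix ε r η ((z - w).1, ξ)) (z - w).2 :=
    lap_comp_const_sub (f := fun ξ => parametrix ε r η ((z - w).1, ξ))
      ((contDiff_infty.1 (contDiff_parametrix hε r hη) 2).comp (contDiff_prodMk_right _)) z.2 w.2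
  rw [e1, e2]
  ring

/-! ### Continuity of the remainder -/

/-- In the variable `1/τ` this is a power against a decaying exponential. It expresses that the heat
kernel at squared distance `d > 0` from the origin vanishes faster than any power of `τ`. -/
theorem tendsto_inv_pow_mul_exp_log_sub (n : ℝ) (j : ℕ) {d : ℝ} (hd : 0 < d) :
    Tendsto (fun τ : ℝ => τ⁻¹ ^ j * Real.exp (-n * Real.log (4 * Real.pi * τ) - (4 * τ)⁻¹ * d))
      (𝓝[>] 0) (𝓝 0) := by
  have h1 := (tendsto_rpow_mul_exp_neg_mul_atTop_nhds_zero (n + j) (d / 4) (by positivity)).comp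
    tendsto_inv_nhdsGT_zero
  have h2 := h1.const_mul (Real.exp (-n * Real.log (4 * Real.pi)))
  rw [mul_zero] at h2
  refine h2.congr' ?_
  filter_upwards [self_mem_nhdsWithin] with τ hτ
  have hτ0 : (0 : ℝ) < τ := hτ
  have hπ := Real.pi_pos
  simp only [Function.comp_apply]
  rw [Real.rpow_add (inv_pos.2 hτ0), Real.rpow_natCast, Real.rpow_def_of_pos (inv_pos.2 hτ0),
    Real.log_inv, Real.log_mul (by positivity) hτ0.ne']
  have e : -n * (Real.log (4 * Real.pi) + Real.log τ) - (4 * τ)⁻¹ * d =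
      -n * Real.log (4 * Real.pi) + -Real.log τ * n + -(d / 4) * τ⁻¹ := by
    field_simp
    ring
  rw [e, Real.exp_add, Real.exp_add]
  ring

/-- Only `τ = 0` is in question. Where `c` does not vanish one has `‖ξ‖ ≥ δ`, so the kernel is at
most its value at distance `δ`, and this beats `τ⁻¹ ^ j`. -/
theorem continuous_ite_mul_heatKernel {c : Space N → ℝ} (hc : Continuous c) {δ : ℝ} (hδ : 0 < δ)
    (hcδ : ∀ ξ, ‖ξ‖ < δ → c ξ = 0) (j : ℕ) :
    Continuous fun z : ℝ × Space N =>
      if 0 < z.1 then c z.2 * (z.1⁻¹ ^ j * heatKernel z.1 z.2) else 0 := by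
  refine continuous_iff_continuousAt.2 fun z => ?_
  rcases lt_trichotomy z.1 0 with h | h | h
  · refine (continuousAt_const (y := (0 : ℝ))).congr ?_
    filter_upwards [(isOpen_Iio.preimage continuous_fst).mem_nhds h] with w hw
    have hw' : w.1 < 0 := hw
    rw [if_neg (not_lt.2 hw'.le)]
  · have hg : Tendsto (fun τ : ℝ => if 0 < τ then τ⁻¹ ^ j *
        Real.exp (-(N / 2 : ℝ) * Real.log (4 * Real.pi * τ) - (4 * τ)⁻¹ * δ ^ 2) else 0)
        (𝓝 0) (𝓝 0) := by
      have hsup := nhdsLE_sup_nhdsGT (0 : ℝ)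
      refine (Tendsto.sup ?_ ?_).mono_left hsup.ge
      · refine tendsto_const_nhds.congr' ?_
        filter_upwards [self_mem_nhdsWithin] with τ hτ
        rw [if_neg (not_lt.2 hτ)]
      · refine (tendsto_inv_pow_mul_exp_log_sub (N / 2 : ℝ) j (d := δ ^ 2) (by positivity)).congr' ?_
        filter_upwards [self_mem_nhdsWithin] with τ hτ
        rw [if_pos (mem_Ioi.1 hτ)]
    have hlim : Tendsto (fun w : ℝ × Space N => |c w.2| * if 0 < w.1 then w.1⁻¹ ^ j *
        Real.exp (-(N / 2 : ℝ) * Real.log (4 * Real.pi * w.1) - (4 * w.1)⁻¹ * δ ^ 2) else 0)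
        (𝓝 z) (𝓝 0) := by
      have h1 : Tendsto (fun w : ℝ × Space N => |c w.2|) (𝓝 z) (𝓝 |c z.2|) :=
        ((hc.comp continuous_snd).abs).tendsto z
      have h2 : Tendsto (fun w : ℝ × Space N => w.1) (𝓝 z) (𝓝 0) := by
        rw [← h]; exact continuous_fst.tendsto z
      simpa using h1.mul (hg.comp h2)
    rw [ContinuousAt, if_neg (by rw [h]; exact lt_irrefl 0)]
    refine squeeze_zero_norm (fun w => ?_) hlim
    split_ifs with hw
    · rw [norm_mul, Real.norm_eq_abs]
      rcases lt_or_ge ‖w.2‖ δ with hlt | hge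
      · simp [hcδ _ hlt]
      · refine mul_le_mul_of_nonneg_left ?_ (abs_nonneg _)
        have : 0 ≤ w.1⁻¹ ^ j * heatKernel w.1 w.2 :=
          mul_nonneg (by positivity) (heatKernel_pos _ _).le
        rw [Real.norm_of_nonneg this]
        refine mul_le_mul_of_nonneg_left ?_ (by positivity)
        refine Real.exp_le_exp.2 (sub_le_sub_left ?_ _)
        gcongr
    · simp
  · have h1 : ContinuousAt (fun z : ℝ × Space N => c z.2 * (z.1⁻¹ ^ j * heatKernel z.1 z.2)) z :=
      (hc.comp continuous_snd).continuousAt.mul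
        (((continuousAt_fst.inv₀ h.ne').pow j).mul
          (contDiffAt_heatKernel (n := 0) h).continuousAt)
    refine h1.congr ?_
    filter_upwards [(isOpen_Ioi.preimage continuous_fst).mem_nhds h] with w hw
    have hw' : 0 < w.1 := hw
    rw [if_pos hw']

/-- Cutoff functions in space. -/
structure IsCutoff (r : ℝ) (η : Space N → ℝ) : Prop where
  contDiff : ContDiff ℝ ∞ η
  eq_one : ∀ ξ, ‖ξ‖ < r / 2 → η ξ = 1
  eq_zero : ∀ ξ, r ≤ ‖ξ‖ → η ξ = 0
  nonneg : ∀ ξ, 0 ≤ η ξ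
  le_one : ∀ ξ, η ξ ≤ 1

theorem exists_isCutoff {r : ℝ} (hr : 0 < r) : ∃ η : Space N → ℝ, IsCutoff r η := by
  let B : ContDiffBump (0 : Space N) := ⟨r / 2, r, by positivity, by linarith⟩
  refine ⟨B, B.contDiff, fun ξ hξ => B.one_of_mem_closedBall ?_, fun ξ hξ => B.zero_of_le_dist ?_,
    fun ξ => B.nonneg, fun ξ => B.le_one⟩
  · simpa using hξ.le
  · simpa using hξ

theorem IsCutoff.fderiv_eq_zero {r : ℝ} {η : Space N → ℝ} (hη : IsCutoff r η) {ξ : Space N}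
    (hξ : ‖ξ‖ < r / 2) : fderiv ℝ η ξ = 0 := by
  have : η =ᶠ[𝓝 ξ] fun _ => (1 : ℝ) := by
    filter_upwards [(isOpen_lt continuous_norm continuous_const).mem_nhds hξ] with y hy
    exact hη.eq_one y hy
  rw [this.fderiv_eq]
  simp

theorem IsCutoff.lap_eq_zero {r : ℝ} {η : Space N → ℝ} (hη : IsCutoff r η) {ξ : Space N}
    (hξ : ‖ξ‖ < r / 2) : lap η ξ = 0 := by
  refine Finset.sum_eq_zero fun i _ => ?_
  have : (fun y => fderiv ℝ η y (stdVec i)) =ᶠ[𝓝 ξ] fun _ => (0 : ℝ) := by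
    filter_upwards [(isOpen_lt continuous_norm continuous_const).mem_nhds hξ] with y hy
    rw [hη.fderiv_eq_zero hy]
    simp
  rw [this.fderiv_eq]
  simp

theorem IsCutoff.tsupport_subset {r : ℝ} {η : Space N → ℝ} (hη : IsCutoff r η) :
    tsupport η ⊆ Metric.closedBall 0 r := by
  refine closure_minimal (fun ξ hξ => ?_) Metric.isClosed_closedBall
  by_contra h
  rw [mem_closedBall_zero_iff, not_le] at h
  exact hξ (hη.eq_zero ξ h.le)

/-- Every term stays away from the singularity at the origin: the derivative of `timeCut` vanishes
for `τ < r / 2`, and the derivatives of `η` vanish for `‖ξ‖ < r / 2`. -/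
theorem continuous_remainder {r : ℝ} (hr : 0 < r) {η : Space N → ℝ} (hη : IsCutoff r η) :
    Continuous (remainder r η) := by
  have hη2 : ContDiff ℝ 2 η := contDiff_infty.1 hη.contDiff 2
  have hr2 : 0 < r / 2 := by positivity
  have h1 : Continuous fun z : ℝ × Space N =>
      (deriv (timeCut r) z.1 * η z.2) * heatKernel z.1 z.2 := by
    refine (contDiff_mul_heatKernel (n := 0)
      (a := fun z : ℝ × Space N => deriv (timeCut r) z.1 * η z.2) ?_ hr2 ?_).continuous
    · have := continuous_deriv_timeCut r
      have := hη.contDiff.continuous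
      rw [contDiff_zero]
      fun_prop
    · intro z hz
      simp [deriv_timeCut_of_lt hr hz]
  have h2 := continuous_ite_mul_heatKernel (continuous_lap hη2) hr2
    (fun ξ hξ => hη.lap_eq_zero hξ) 0
  have h3 := continuous_ite_mul_heatKernel (c := fun ξ => fderiv ℝ η ξ ξ)
    ((hη2.continuous_fderiv (by norm_num)).clm_apply continuous_id) hr2
    (fun ξ hξ => by simp [hη.fderiv_eq_zero hξ]) 1
  have h4 : Continuous fun z : ℝ × Space N => timeCut r z.1 :=
    (contDiff_timeCut r).continuous.comp continuous_fst
  refine (h1.sub (h4.mul (h2.sub h3))).congr fun z => ?_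
  simp only [remainder, Pi.sub_apply, Pi.mul_apply]
  split_ifs with h
  · ring
  · rw [deriv_timeCut_of_lt (τ := z.1) hr (by linarith)]
    ring

theorem hasCompactSupport_remainder {r : ℝ} (hr : 0 < r) {η : Space N → ℝ} (hη : IsCutoff r η) :
    HasCompactSupport (remainder r η) := by
  refine HasCompactSupport.intro (K := Icc 0 r ×ˢ Metric.closedBall 0 r)
    (isCompact_Icc.prod (isCompact_closedBall _ _)) fun z hz => ?_
  unfold remainder
  split_ifs with h
  · rcases lt_or_ge r z.1 with h1 | h1
    · simp [deriv_timeCut_of_gt hr h1, timeCut_eq_zero hr h1.le]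
    · have h2 : z.2 ∉ tsupport η := fun h2 => hz ⟨⟨h.le, h1⟩, hη.tsupport_subset h2⟩
      have h3 : fderiv ℝ η z.2 = 0 := by
        rw [(notMem_tsupport_iff_eventuallyEq.1 h2).fderiv_eq]
        exact fderiv_const_apply _
      simp [image_eq_zero_of_notMem_tsupport h2, lap_eq_zero_of_notMem_tsupport h2, h3]
  · rfl

/-! ### The peak is an approximate identity -/

theorem heatKernel_eq_mul (τ : ℝ) (ξ : Space N) :
    heatKernel τ ξ = Real.exp (-(N / 2 : ℝ) * Real.log (4 * Real.pi * τ)) *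
      Real.exp (-(4 * τ)⁻¹ * ‖ξ‖ ^ 2) := by
  rw [heatKernel, ← Real.exp_add]
  congr 1
  ring

theorem integral_heatKernel {τ : ℝ} (hτ : 0 < τ) : ∫ ξ : Space N, heatKernel τ ξ = 1 := by
  have hπ := Real.pi_pos
  simp only [heatKernel_eq_mul]
  rw [integral_const_mul, GaussianFourier.integral_rexp_neg_mul_sq_norm (by positivity)]
  have e : Real.pi / (4 * τ)⁻¹ = 4 * Real.pi * τ := by field_simp
  rw [e, Real.rpow_def_of_pos (by positivity), ← Real.exp_add, finrank_euclideanSpace_fin,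
    ← Real.exp_zero]
  congr 1
  ring

theorem integrable_heatKernel {τ : ℝ} (hτ : 0 < τ) :
    Integrable (heatKernel τ : Space N → ℝ) :=
  integrable_of_integral_eq_one (integral_heatKernel hτ)

theorem continuous_heatKernel (τ : ℝ) : Continuous (heatKernel τ : Space N → ℝ) := by
  unfold heatKernel
  fun_prop

theorem heatKernel_sqrt_smul {τ : ℝ} (hτ : 0 < τ) (ζ : Space N) :
    heatKernel τ (√τ • ζ) = (√τ ^ N)⁻¹ * heatKernel 1 ζ := by
  have hπ := Real.pi_pos
  have hs : √τ ^ N = Real.exp ((N / 2 : ℝ) * Real.log τ) := by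
    have h0 : 0 < √τ := Real.sqrt_pos.2 hτ
    rw [← Real.rpow_natCast, Real.rpow_def_of_pos h0, Real.log_sqrt hτ.le]
    congr 1
    ring
  rw [hs, ← Real.exp_neg, heatKernel, heatKernel, ← Real.exp_add, norm_smul, mul_pow,
    Real.norm_eq_abs, sq_abs, Real.sq_sqrt hτ.le, Real.log_mul (by positivity) hτ.ne']
  congr 1
  field_simp
  ring

/-- Parabolic scaling replaces the varying kernel by the fixed probability density `heatKernel 1`,
which prepares dominated convergence as `τ → 0`. -/
theorem integral_heatKernel_mul {τ : ℝ} (hτ : 0 < τ) (F : Space N → ℝ) :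
    ∫ ξ, heatKernel τ ξ * F ξ = ∫ ζ, heatKernel 1 ζ * F (√τ • ζ) := by
  have h0 : 0 < √τ := Real.sqrt_pos.2 hτ
  have h := Measure.integral_comp_smul volume (fun ξ : Space N => heatKernel τ ξ * F ξ) (√τ)
  simp only [heatKernel_sqrt_smul hτ, mul_assoc, smul_eq_mul] at h
  rw [integral_const_mul, finrank_euclideanSpace_fin, abs_of_pos (by positivity)] at h
  exact (mul_left_cancel₀ (by positivity) h).symm

theorem tendsto_integral_heatKernel_mul {F : ℝ × Space N → ℝ} (hF : Continuous F) {C : ℝ}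
    (hC : ∀ z, |F z| ≤ C) :
    Tendsto (fun τ => ∫ ξ, heatKernel τ ξ * F (τ, ξ)) (𝓝[>] 0) (𝓝 (F 0)) := by
  have h1 : Tendsto (fun τ : ℝ => ∫ ζ : Space N, heatKernel 1 ζ * F (τ, √τ • ζ)) (𝓝[>] 0)
      (𝓝 (∫ ζ : Space N, heatKernel 1 ζ * F 0)) := by
    refine tendsto_integral_filter_of_dominated_convergence
      (fun ζ => heatKernel 1 ζ * C) ?_ ?_ ((integrable_heatKernel one_pos).mul_const C) ?_
    · refine Eventually.of_forall fun τ => Continuous.aestronglyMeasurable ?_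
      have := continuous_heatKernel (N := N) 1
      fun_prop
    · refine Eventually.of_forall fun τ => Eventually.of_forall fun ζ => ?_
      rw [norm_mul, Real.norm_of_nonneg (heatKernel_pos _ _).le]
      exact mul_le_mul_of_nonneg_left (hC _) (heatKernel_pos _ _).le
    · refine Eventually.of_forall fun ζ => Tendsto.const_mul _ ?_
      have hc : Continuous fun τ : ℝ => F (τ, √τ • ζ) := by fun_prop
      have := hc.tendsto 0
      simp only [Real.sqrt_zero, zero_smul] at this
      exact this.mono_left nhdsWithin_le_nhds
  rw [integral_mul_const, integral_heatKernel one_pos, one_mul] at h1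
  refine h1.congr' ?_
  filter_upwards [self_mem_nhdsWithin] with τ hτ
  exact (integral_heatKernel_mul hτ fun ξ => F (τ, ξ)).symm

theorem hasCompactSupport_deriv_timeOn {ε : ℝ} (hε : 0 < ε) :
    HasCompactSupport (deriv (timeOn ε)) := by
  refine HasCompactSupport.intro (K := Icc ε (2 * ε)) isCompact_Icc fun τ hτ => ?_
  rcases lt_or_ge τ ε with h | h
  · exact deriv_timeOn_of_lt hε h
  · exact deriv_timeOn_of_gt hε (not_le.1 fun h' => hτ ⟨h, h'⟩)

theorem integrable_deriv_timeOn {ε : ℝ} (hε : 0 < ε) : Integrable (deriv (timeOn ε)) :=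
  (continuous_deriv_timeOn ε).integrable_of_hasCompactSupport (hasCompactSupport_deriv_timeOn hε)

theorem integral_deriv_timeOn {ε : ℝ} (hε : 0 < ε) : ∫ τ, deriv (timeOn ε) τ = 1 := by
  have h1 : ∫ τ in (0 : ℝ)..(3 * ε), deriv (timeOn ε) τ = 1 := by
    rw [intervalIntegral.integral_deriv_eq_sub
      (fun τ _ => (contDiff_timeOn ε).differentiable (by simp) τ)
      ((continuous_deriv_timeOn ε).intervalIntegrable _ _),
      timeOn_eq_one hε (by linarith), timeOn_eq_zero hε hε.le, sub_zero]
  rw [intervalIntegral.integral_of_le (by positivity),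
    setIntegral_eq_integral_of_forall_compl_eq_zero] at h1
  · exact h1
  · intro τ hτ
    rcases lt_or_ge τ ε with h | h
    · exact deriv_timeOn_of_lt hε h
    · exact deriv_timeOn_of_gt hε (not_le.1 fun h' => hτ ⟨by linarith, by linarith⟩)

theorem hasCompactSupport_peak {ε r : ℝ} (hε : 0 < ε) {η : Space N → ℝ} (hη : IsCutoff r η) :
    HasCompactSupport (peak ε r η) := by
  refine HasCompactSupport.intro (K := tsupport (deriv (timeOn ε)) ×ˢ tsupport η)
    ((hasCompactSupport_deriv_timeOn hε).isCompact.prod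
      ((isCompact_closedBall _ _).of_isClosed_subset (isClosed_tsupport _) hη.tsupport_subset))
    fun z hz => ?_
  by_cases h : z.1 ∈ tsupport (deriv (timeOn ε))
  · have : z.2 ∉ tsupport η := fun h' => hz ⟨h, h'⟩
    simp [peak, image_eq_zero_of_notMem_tsupport this]
  · simp [peak, image_eq_zero_of_notMem_tsupport h]

/-- By Fubini, integration against the peak is an average in `τ` of heat-kernel integrals, with
weight the derivative of `timeOn ε`: nonnegative, of mass one and carried by `[ε, 2ε]`. -/
theorem integral_peak_mul {ε r : ℝ} (hε : 0 < ε) {η : Space N → ℝ}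
    (hη : IsCutoff r η) {g : ℝ × Space N → ℝ} (hg : Continuous g) :
    Integrable (fun τ => deriv (timeOn ε) τ *
        ∫ ξ, heatKernel τ ξ * (timeCut r τ * η ξ * g (τ, ξ))) ∧
      ∫ z, peak ε r η z * g z = ∫ τ, deriv (timeOn ε) τ *
        ∫ ξ, heatKernel τ ξ * (timeCut r τ * η ξ * g (τ, ξ)) := by
  have hi : Integrable (fun z => peak ε r η z * g z) :=
    ((continuous_peak hε r hη.contDiff.continuous).mul hg).integrable_of_hasCompactSupport
      (hasCompactSupport_peak hε hη).mul_right
  have e : ∀ τ, ∫ ξ, peak ε r η (τ, ξ) * g (τ, ξ) = deriv (timeOn ε) τ *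
        ∫ ξ, heatKernel τ ξ * (timeCut r τ * η ξ * g (τ, ξ)) := fun τ => by
    rw [← integral_const_mul]
    congr 1
    funext ξ
    simp only [peak]
    ring
  rw [Measure.volume_eq_prod] at hi
  refine ⟨?_, ?_⟩
  · simpa only [e] using hi.integral_prod_left
  · rw [Measure.volume_eq_prod, integral_prod _ hi]
    simp only [e]

/-- A bound for averages against the peak from a bound for averages against the heat kernel. -/
theorem abs_integral_peak_mul_sub_le {ε r : ℝ} (hε : 0 < ε) {η : Space N → ℝ}
    (hη : IsCutoff r η) {g : ℝ × Space N → ℝ} (hg : Continuous g) {l δ : ℝ}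
    (h : ∀ τ ∈ Icc ε (2 * ε), |(∫ ξ, heatKernel τ ξ * (timeCut r τ * η ξ * g (τ, ξ))) - l| ≤ δ) :
    |(∫ z, peak ε r η z * g z) - l| ≤ δ := by
  obtain ⟨hi, he⟩ := integral_peak_mul hε hη hg
  have hd := integrable_deriv_timeOn hε
  have e1 : (∫ z, peak ε r η z * g z) - l = ∫ τ, (deriv (timeOn ε) τ *
      (∫ ξ, heatKernel τ ξ * (timeCut r τ * η ξ * g (τ, ξ))) - l * deriv (timeOn ε) τ) := by
    rw [integral_sub hi (hd.const_mul l), integral_const_mul, integral_deriv_timeOn hε, he, mul_one]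
  have e2 : δ = ∫ τ, δ * deriv (timeOn ε) τ := by
    rw [integral_const_mul, integral_deriv_timeOn hε, mul_one]
  rw [e1, e2, ← Real.norm_eq_abs]
  refine norm_integral_le_of_norm_le (hd.const_mul δ) (Eventually.of_forall fun τ => ?_)
  rw [mul_comm l, ← mul_sub, norm_mul, Real.norm_of_nonneg (deriv_timeOn_nonneg hε τ), mul_comm]
  by_cases hτ : τ ∈ Icc ε (2 * ε)
  · exact mul_le_mul_of_nonneg_right (h τ hτ) (deriv_timeOn_nonneg hε τ)
  · have : deriv (timeOn ε) τ = 0 := by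
      rcases lt_or_ge τ ε with h | h
      · exact deriv_timeOn_of_lt hε h
      · exact deriv_timeOn_of_gt hε (not_le.1 fun h' => hτ ⟨h, h'⟩)
    simp [this]

theorem IsCutoff.abs_mul_le {r : ℝ} {η : Space N → ℝ} (hη : IsCutoff r η) {g : ℝ × Space N → ℝ}
    {C : ℝ} (hC : ∀ z, |g z| ≤ C) (z : ℝ × Space N) : |timeCut r z.1 * η z.2 * g z| ≤ C := by
  rw [abs_mul, abs_of_nonneg (mul_nonneg (timeCut_nonneg _ _) (hη.nonneg _))]
  have h1 : timeCut r z.1 * η z.2 ≤ 1 :=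
    mul_le_one₀ (timeCut_le_one _ _) (hη.nonneg _) (hη.le_one _)
  calc _ ≤ 1 * |g z| := mul_le_mul_of_nonneg_right h1 (abs_nonneg _)
    _ ≤ C := by rw [one_mul]; exact hC z

theorem abs_integral_peak_mul_le {ε r : ℝ} (hε : 0 < ε) {η : Space N → ℝ}
    (hη : IsCutoff r η) {g : ℝ × Space N → ℝ} (hg : Continuous g) {C : ℝ} (hC : ∀ z, |g z| ≤ C) :
    |∫ z, peak ε r η z * g z| ≤ C := by
  have := abs_integral_peak_mul_sub_le hε hη hg (l := 0) (δ := C) ?_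
  · simpa using this
  intro τ hτ
  have hτ0 : 0 < τ := hε.trans_le hτ.1
  rw [sub_zero]
  have h1 := norm_integral_le_of_norm_le ((integrable_heatKernel (N := N) hτ0).mul_const C)
    (f := fun ξ => heatKernel τ ξ * (timeCut r τ * η ξ * g (τ, ξ)))
    (Eventually.of_forall fun ξ => ?_)
  · rwa [integral_mul_const, integral_heatKernel hτ0, one_mul] at h1
  · rw [norm_mul, Real.norm_of_nonneg (heatKernel_pos _ _).le]
    exact mul_le_mul_of_nonneg_left (hη.abs_mul_le hC (τ, ξ)) (heatKernel_pos _ _).le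

theorem tendsto_integral_peak_mul {r : ℝ} (hr : 0 < r) {η : Space N → ℝ} (hη : IsCutoff r η)
    {g : ℝ × Space N → ℝ} (hg : Continuous g) {C : ℝ} (hC : ∀ z, |g z| ≤ C) {ε : ℕ → ℝ}
    (hε : ∀ j, 0 < ε j) (hεl : Tendsto ε atTop (𝓝 0)) :
    Tendsto (fun j => ∫ z, peak (ε j) r η z * g z) atTop (𝓝 (g 0)) := by
  have hF : Continuous fun z : ℝ × Space N => timeCut r z.1 * η z.2 * g z := by
    have h1 := (contDiff_timeCut r).continuous
    have h2 := hη.contDiff.continuous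
    fun_prop
  have h0 := tendsto_integral_heatKernel_mul hF (hη.abs_mul_le hC)
  simp only [Prod.fst_zero, Prod.snd_zero, timeCut_eq_one hr (half_pos hr).le,
    hη.eq_one 0 (by simpa using hr), one_mul] at h0
  rw [Metric.tendsto_atTop]
  intro δ hδ
  have h1 := (Metric.tendsto_nhds.1 h0 (δ / 2) (half_pos hδ))
  obtain ⟨a, ha, hsub⟩ := (mem_nhdsGT_iff_exists_Ioo_subset).1 h1
  have ha' : (0 : ℝ) < a := ha
  -- The peak involves only times up to `2ε`, so `ε < a / 2` keeps them below `a`.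
  obtain ⟨n, hn⟩ := eventually_atTop.1 (hεl.eventually (gt_mem_nhds (half_pos ha')))
  refine ⟨n, fun j hj => ?_⟩
  rw [Real.dist_eq]
  refine lt_of_le_of_lt (abs_integral_peak_mul_sub_le (hε j) hη hg (δ := δ / 2) fun τ hτ => ?_)
    (half_lt_self hδ)
  have : τ ∈ Ioo 0 a := ⟨(hε j).trans_le hτ.1, by linarith [hτ.2, hn j hj]⟩
  have hlt : dist (∫ ξ, heatKernel τ ξ * (timeCut r τ * η ξ * g (τ, ξ))) (g 0) < δ / 2 := hsub this
  exact hlt.le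

/-! ### Interior continuity -/

/-- The representation of a weak solution by the remainder kernel, in weak form. -/
theorem IsWeakSolution.setIntegral_mul_eq {T : ℝ} {Ω : Set (Space N)}
    (hΩb : Bornology.IsBounded Ω) {b : ℝ} {f : Space N → ℝ}
    {u : ℝ × Space N → ℝ} (hu : IsWeakSolution T Ω b f u) {r : ℝ} (hr : 0 < r)
    {η : Space N → ℝ} (hη : IsCutoff r η) {U : Set (ℝ × Space N)}
    (hU : ∀ z ∈ U, r < z.1 ∧ z.1 < T ∧ Metric.closedBall z.2 r ⊆ Ω) {ψ : ℝ × Space N → ℝ}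
    (hψ : IsTest U ψ) :
    ∫ w in cylinder T Ω, u w * ψ w =
      -∫ z, ψ z * ∫ w in cylinder T Ω, u w * remainder r η (z - w) := by
  have hfin : IsFiniteMeasure ((volume : Measure (Space N)).restrict Ω) :=
    ⟨by simpa using hΩb.measure_lt_top⟩
  set π := (volume : Measure (ℝ × Space N)).restrict (cylinder T Ω) with hπ
  have hπf : IsFiniteMeasure π := by rw [hπ, restrict_cylinder]; infer_instance
  have hui : Integrable u π := hu.1.integrable (by norm_num)
  have hψc : Continuous ψ := hψ.1.continuous
  have hψi : Integrable ψ := hψc.integrable_of_hasCompactSupport hψ.2.1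
  obtain ⟨C, hC⟩ := hψc.bounded_above_of_compact_support hψ.2.1
  have hrc := continuous_remainder hr hη
  obtain ⟨R, hR⟩ := hrc.bounded_above_of_compact_support (hasCompactSupport_remainder hr hη)
  have hψu : Integrable (fun p : (ℝ × Space N) × (ℝ × Space N) => ψ p.1 * u p.2)
      ((volume : Measure (ℝ × Space N)).prod π) := hψi.mul_prod hui
  have hsub : Continuous fun p : (ℝ × Space N) × (ℝ × Space N) => p.1 - p.2 :=
    continuous_fst.sub continuous_snd
  have hker : ∀ {k : ℝ × Space N → ℝ} {M : ℝ}, Continuous k → (∀ z, ‖k z‖ ≤ M) →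
      Integrable (fun p : (ℝ × Space N) × (ℝ × Space N) => ψ p.1 * u p.2 * k (p.1 - p.2))
        ((volume : Measure (ℝ × Space N)).prod π) := fun hk hM =>
    hψu.mul_bdd (hk.comp hsub).aestronglyMeasurable (Eventually.of_forall fun p => hM _)
  have hε : ∀ j : ℕ, (0 : ℝ) < 1 / ((j : ℝ) + 1) := fun j => Nat.one_div_pos_of_nat
  have hεl : Tendsto (fun j : ℕ => (1 : ℝ) / ((j : ℝ) + 1)) atTop (𝓝 0) :=
    tendsto_one_div_add_atTop_nhds_zero_nat
  have hpi : ∀ j : ℕ, Integrable (fun p : (ℝ × Space N) × (ℝ × Space N) => ψ p.1 * u p.2 *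
      peak (1 / ((j : ℝ) + 1)) r η (p.1 - p.2)) ((volume : Measure (ℝ × Space N)).prod π) := by
    intro j
    have hpc := continuous_peak (hε j) r hη.contDiff.continuous
    obtain ⟨M, hM⟩ := hpc.bounded_above_of_compact_support (hasCompactSupport_peak (hε j) hη)
    exact hker hpc hM
  have hθrc : ∀ j : ℕ, Continuous fun z : ℝ × Space N =>
      timeOn (1 / ((j : ℝ) + 1)) z.1 * remainder r η z := fun j =>
    ((contDiff_timeOn _).continuous.comp continuous_fst).mul hrc
  have hθrb : ∀ (j : ℕ) (z : ℝ × Space N),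
      ‖timeOn (1 / ((j : ℝ) + 1)) z.1 * remainder r η z‖ ≤ R := by
    intro j z
    rw [norm_mul, Real.norm_of_nonneg (timeOn_nonneg _ _)]
    calc _ ≤ 1 * ‖remainder r η z‖ :=
          mul_le_mul_of_nonneg_right (timeOn_le_one _ _) (norm_nonneg _)
      _ ≤ R := by rw [one_mul]; exact hR z
  have hri : ∀ j : ℕ, Integrable (fun p : (ℝ × Space N) × (ℝ × Space N) => ψ p.1 * u p.2 *
      (timeOn (1 / ((j : ℝ) + 1)) (p.1 - p.2).1 * remainder r η (p.1 - p.2)))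
      ((volume : Measure (ℝ × Space N)).prod π) := fun j => hker (hθrc j) (hθrb j)
  -- For `z` in the support of `ψ` the parametrix based at `z` is an admissible test function, so
  -- the inner integral over `w` vanishes; elsewhere `ψ z = 0`.
  have hzero : ∀ j : ℕ, (∫ p : (ℝ × Space N) × (ℝ × Space N), ψ p.1 * u p.2 *
      peak (1 / ((j : ℝ) + 1)) r η (p.1 - p.2) ∂(volume : Measure (ℝ × Space N)).prod π) =
      -∫ p : (ℝ × Space N) × (ℝ × Space N), ψ p.1 * u p.2 *
      (timeOn (1 / ((j : ℝ) + 1)) (p.1 - p.2).1 * remainder r η (p.1 - p.2))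
        ∂(volume : Measure (ℝ × Space N)).prod π := by
    intro j
    rw [eq_neg_iff_add_eq_zero, ← integral_add (hpi j) (hri j)]
    rw [integral_prod _ (by exact (hpi j).add (hri j))]
    refine integral_eq_zero_of_ae (Eventually.of_forall fun z => ?_)
    simp only [← mul_add, mul_assoc]
    rw [integral_const_mul]
    by_cases hz : z ∈ tsupport ψ
    · obtain ⟨h1, h2, h3⟩ := hU z (hψ.2.2 hz)
      rw [hπ, hu.setIntegral_mul_peak_add_remainder hΩb (hε j) hr hη.contDiff hη.eq_zero h1 h2 h3,
        mul_zero, Pi.zero_apply]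
    · rw [image_eq_zero_of_notMem_tsupport hz, zero_mul, Pi.zero_apply]
  -- Integrating in `z` before `w` lets the peak act on the smooth function `ψ` instead of on `u`,
  -- so no regularity of `u` is required.
  have hlim1 : Tendsto (fun j : ℕ => ∫ p : (ℝ × Space N) × (ℝ × Space N), ψ p.1 * u p.2 *
      peak (1 / ((j : ℝ) + 1)) r η (p.1 - p.2) ∂(volume : Measure (ℝ × Space N)).prod π) atTop
      (𝓝 (∫ w, u w * ψ w ∂π)) := by
    have hin : ∀ (j : ℕ) (w : ℝ × Space N),
        ∫ z, ψ z * u w * peak (1 / ((j : ℝ) + 1)) r η (z - w) =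
          u w * ∫ z, peak (1 / ((j : ℝ) + 1)) r η z * ψ (z + w) := by
      intro j w
      have : (volume : Measure (ℝ × Space N)).IsAddLeftInvariant := by
        rw [Measure.volume_eq_prod]; infer_instance
      have : (volume : Measure (ℝ × Space N)).IsAddRightInvariant :=
        IsAddLeftInvariant.isAddRightInvariant
      rw [← integral_const_mul, ← integral_sub_right_eq_self
        (fun z => u w * (peak (1 / ((j : ℝ) + 1)) r η z * ψ (z + w))) w]
      refine integral_congr_ae (Eventually.of_forall fun z => ?_)
      dsimp only
      rw [sub_add_cancel]
      ring
    have e : ∀ j : ℕ, (∫ p : (ℝ × Space N) × (ℝ × Space N), ψ p.1 * u p.2 *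
        peak (1 / ((j : ℝ) + 1)) r η (p.1 - p.2) ∂(volume : Measure (ℝ × Space N)).prod π) =
        ∫ w, (u w * ∫ z, peak (1 / ((j : ℝ) + 1)) r η z * ψ (z + w)) ∂π := by
      intro j
      rw [integral_prod_symm _ (hpi j)]
      simp only [hin]
    simp only [e]
    have hc : ∀ w : ℝ × Space N, Continuous fun z => ψ (z + w) := fun w =>
      hψc.comp (continuous_id.add continuous_const)
    refine tendsto_integral_of_dominated_convergence (fun w => ‖u w‖ * C) ?_
      (hui.norm.mul_const C) ?_ ?_
    · intro j
      have := (hpi j).integral_prod_right.1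
      simpa only [hin] using this
    · intro j
      refine Eventually.of_forall fun w => ?_
      rw [norm_mul]
      exact mul_le_mul_of_nonneg_left
        (abs_integral_peak_mul_le (hε j) hη (hc w) fun z => hC _) (norm_nonneg _)
    · refine Eventually.of_forall fun w => Tendsto.const_mul _ ?_
      have := tendsto_integral_peak_mul hr hη (hc w) (fun z => hC _) hε hεl
      rwa [zero_add] at this
  -- Pointwise, the remainder is zero at nonpositive times, and at a positive time `timeOn` is
  -- eventually `1`.
  have hlim2 : Tendsto (fun j : ℕ => ∫ p : (ℝ × Space N) × (ℝ × Space N), ψ p.1 * u p.2 *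
      (timeOn (1 / ((j : ℝ) + 1)) (p.1 - p.2).1 * remainder r η (p.1 - p.2))
        ∂(volume : Measure (ℝ × Space N)).prod π) atTop
      (𝓝 (∫ p : (ℝ × Space N) × (ℝ × Space N), ψ p.1 * u p.2 * remainder r η (p.1 - p.2)
        ∂(volume : Measure (ℝ × Space N)).prod π)) := by
    refine tendsto_integral_of_dominated_convergence (fun p => ‖ψ p.1 * u p.2‖ * R)
      (fun j => (hri j).1) (hψu.norm.mul_const R) (fun j => Eventually.of_forall fun p => ?_) ?_
    · rw [norm_mul]
      exact mul_le_mul_of_nonneg_left (hθrb j _) (norm_nonneg _)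
    · refine Eventually.of_forall fun p => Tendsto.const_mul _ ?_
      rcases le_or_gt (p.1 - p.2).1 0 with h | h
      · have : remainder r η (p.1 - p.2) = 0 := if_neg (not_lt.2 h)
        simp [this]
      · refine tendsto_const_nhds.congr' ?_
        filter_upwards [hεl.eventually (gt_mem_nhds (half_pos h))] with j hj
        rw [timeOn_eq_one (hε j) (by linarith), one_mul]
  have hfinal := tendsto_nhds_unique (hlim1.congr hzero) hlim2.neg
  rw [hfinal, integral_prod _ (hker hrc hR)]
  simp only [mul_assoc, integral_const_mul]

/-- The convolution of the integrable `u` with the bounded continuous remainder is continuous, and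
by the weak representation formula it agrees with `u` against every test function on `U`. The
fundamental lemma of the calculus of variations then gives equality almost everywhere on `U`. -/
theorem IsWeakSolution.exists_continuous_ae_eq_nhds {T : ℝ} {Ω : Set (Space N)} (hΩo : IsOpen Ω)
    (hΩb : Bornology.IsBounded Ω) {b : ℝ} {f : Space N → ℝ}
    {u : ℝ × Space N → ℝ} (hu : IsWeakSolution T Ω b f u) {z₀ : ℝ × Space N}
    (hz₀ : z₀ ∈ cylinder T Ω) :
    ∃ U, IsOpen U ∧ z₀ ∈ U ∧ ∃ v : ℝ × Space N → ℝ, Continuous v ∧ ∀ᵐ w, w ∈ U → v w = u w := by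
  obtain ⟨⟨h0, hT⟩, hx⟩ : (0 < z₀.1 ∧ z₀.1 < T) ∧ z₀.2 ∈ Ω := hz₀
  obtain ⟨ρ, hρ, hρs⟩ := Metric.isOpen_iff.1 hΩo z₀.2 hx
  -- The bound `ρ / 2` keeps balls of radius `r` centred in the ball of radius `r` around `z₀.2`
  -- inside `Ω`. The bound `z₀.1 / 2` puts `z₀` itself at a time later than `r`.
  set r := min (ρ / 2) (z₀.1 / 2) with hrdef
  have hr : 0 < r := by positivity
  have hr1 : r ≤ ρ / 2 := min_le_left _ _
  have hr2 : r ≤ z₀.1 / 2 := min_le_right _ _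
  set U : Set (ℝ × Space N) := Ioo r T ×ˢ Metric.ball z₀.2 r with hUdef
  have hUo : IsOpen U := isOpen_Ioo.prod Metric.isOpen_ball
  have hU : ∀ z ∈ U, r < z.1 ∧ z.1 < T ∧ Metric.closedBall z.2 r ⊆ Ω := by
    rintro z ⟨h1, h2⟩
    refine ⟨h1.1, h1.2, fun y hy => hρs ?_⟩
    rw [Metric.mem_ball] at h2 ⊢
    rw [Metric.mem_closedBall] at hy
    linarith [dist_triangle y z.2 z₀.2]
  have hUQ : U ⊆ cylinder T Ω := fun z hz =>
    ⟨⟨hr.trans (hU z hz).1, (hU z hz).2.1⟩,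
      (hU z hz).2.2 (Metric.mem_closedBall_self hr.le)⟩
  obtain ⟨η, hη⟩ := exists_isCutoff (N := N) hr
  have hfin : IsFiniteMeasure ((volume : Measure (Space N)).restrict Ω) :=
    ⟨by simpa using hΩb.measure_lt_top⟩
  have hπf : IsFiniteMeasure ((volume : Measure (ℝ × Space N)).restrict (cylinder T Ω)) := by
    rw [restrict_cylinder]; infer_instance
  have hui : Integrable u (volume.restrict (cylinder T Ω)) := hu.1.integrable (by norm_num)
  have hrc := continuous_remainder hr hη
  obtain ⟨R, hR⟩ := hrc.bounded_above_of_compact_support (hasCompactSupport_remainder hr hη)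
  have hQm : MeasurableSet (cylinder T Ω) := (isOpen_Ioo.prod hΩo).measurableSet
  set v : ℝ × Space N → ℝ := fun z => -∫ w in cylinder T Ω, u w * remainder r η (z - w) with hv
  have hvc : Continuous v := by
    refine Continuous.neg (continuous_of_dominated (bound := fun w => ‖u w‖ * R) ?_ ?_ ?_ ?_)
    · exact fun z => hui.1.mul (hrc.comp (continuous_const.sub continuous_id)).aestronglyMeasurable
    · refine fun z => Eventually.of_forall fun w => ?_
      rw [norm_mul]
      exact mul_le_mul_of_nonneg_left (hR _) (norm_nonneg _)
    · exact hui.norm.mul_const R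
    · exact Eventually.of_forall fun w =>
        continuous_const.mul (hrc.comp (continuous_id.sub continuous_const))
  refine ⟨U, hUo, ⟨⟨by linarith, hT⟩, Metric.mem_ball_self hr⟩, v, hvc, ?_⟩
  have hind : Integrable ((cylinder T Ω).indicator u) := (integrable_indicator_iff hQm).2 hui
  have key := hUo.ae_eq_zero_of_integral_contDiff_smul_eq_zero (μ := volume)
    (f := fun z => (cylinder T Ω).indicator u z - v z)
    ((hind.locallyIntegrable.sub hvc.locallyIntegrable).locallyIntegrableOn U) ?_
  · filter_upwards [key] with w hw hwU
    have := hw hwU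
    rw [indicator_of_mem (hUQ hwU)] at this
    linarith
  · intro ψ h1 h2 h3
    have hrep := hu.setIntegral_mul_eq hΩb hr hη hU ⟨h1, h2, h3⟩
    obtain ⟨C, hC⟩ := h1.continuous.bounded_above_of_compact_support h2
    have i1 : Integrable fun z => ψ z * (cylinder T Ω).indicator u z :=
      hind.bdd_mul (c := C) h1.continuous.aestronglyMeasurable (Eventually.of_forall hC)
    have i2 : Integrable fun z => ψ z * v z :=
      (h1.continuous.mul hvc).integrable_of_hasCompactSupport h2.mul_right
    simp only [smul_eq_mul, mul_sub]
    rw [integral_sub i1 i2, sub_eq_zero]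
    have e1 : ∫ z, ψ z * (cylinder T Ω).indicator u z = ∫ w in cylinder T Ω, u w * ψ w := by
      rw [← integral_indicator hQm]
      congr 1
      funext z
      by_cases hz : z ∈ cylinder T Ω
      · simp [hz, mul_comm]
      · simp [hz]
    rw [e1, hrep, ← integral_neg]
    congr 1
    funext z
    simp only [hv]
    ring

/-- A function that is locally almost everywhere equal to continuous functions on an open set is
almost everywhere equal to a function continuous on that set. -/
theorem exists_continuousOn_ae_eq_of_locally {X : Type*} [TopologicalSpace X]
    [SecondCountableTopology X] [MeasurableSpace X] [OpensMeasurableSpace X] {μ : Measure X}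
    [μ.IsOpenPosMeasure] {Q : Set X} (hQ : IsOpen Q) {u : X → ℝ}
    (h : ∀ z ∈ Q, ∃ U, IsOpen U ∧ z ∈ U ∧ ∃ v : X → ℝ, Continuous v ∧ ∀ᵐ w ∂μ, w ∈ U → v w = u w) :
    ∃ v : X → ℝ, ContinuousOn v Q ∧ v =ᵐ[μ.restrict Q] u := by
  classical
  choose! U hUo hzU V hVc hVu using h
  -- Continuous functions that agree almost everywhere on an open set agree on it, so the local
  -- versions are compatible and the diagonal choice `z ↦ V z z` is continuous on `Q`.
  have heq : ∀ z ∈ Q, ∀ w ∈ Q, w ∈ U z → V w w = V z w := by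
    intro z hz w hw hwz
    have hae : V w =ᵐ[μ.restrict (U w ∩ U z)] V z := by
      rw [EventuallyEq, ae_restrict_iff' ((hUo w hw).inter (hUo z hz)).measurableSet]
      filter_upwards [hVu w hw, hVu z hz] with x h1 h2 hx
      rw [h1 hx.1, h2 hx.2]
    exact Measure.eqOn_open_of_ae_eq hae ((hUo w hw).inter (hUo z hz)) (hVc w hw).continuousOn
      (hVc z hz).continuousOn ⟨hzU w hw, hwz⟩
  refine ⟨fun z => V z z, fun z hz => ?_, ?_⟩
  · refine ((hVc z hz).continuousAt.congr ?_).continuousWithinAt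
    filter_upwards [(hUo z hz).mem_nhds (hzU z hz), hQ.mem_nhds hz] with w hw hwQ
    exact (heq z hz w hwQ hw).symm
  · rw [EventuallyEq, ae_restrict_iff' hQ.measurableSet, ae_iff]
    -- Second countability allows the exceptional null sets of the neighbourhoods to be replaced by
    -- countably many.
    refine measure_null_of_locally_null _ fun z hz => ?_
    have hzQ : z ∈ Q := by
      by_contra hn
      exact hz fun h => absurd h hn
    refine ⟨_, inter_mem self_mem_nhdsWithin
      (mem_nhdsWithin_of_mem_nhds ((hUo z hzQ).mem_nhds (hzU z hzQ))), ?_⟩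
    refine measure_mono_null ?_ (ae_iff.1 (hVu z hzQ))
    rintro w ⟨hw, hwU⟩ hn
    exact hw fun hwQ => (heq z hzQ w hwQ hwU).trans (hn hwU)

/-- Weak solutions of the heat equation are continuous in the interior. -/
theorem IsWeakSolution.exists_continuousOn_ae_eq {T : ℝ} {Ω : Set (Space N)} (hΩo : IsOpen Ω)
    (hΩb : Bornology.IsBounded Ω) {b : ℝ} {f : Space N → ℝ}
    {u : ℝ × Space N → ℝ} (hu : IsWeakSolution T Ω b f u) :
    ∃ v : ℝ × Space N → ℝ, ContinuousOn v (cylinder T Ω) ∧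
      v =ᵐ[volume.restrict (cylinder T Ω)] u :=
  exists_continuousOn_ae_eq_of_locally (isOpen_Ioo.prod hΩo) fun _ hz =>
    hu.exists_continuous_ae_eq_nhds hΩo hΩb hz

end HeatLarge
end

/-! ### Divergence of the continuous representatives -/

theorem proposition4p1 {N : ℕ} (hN : 1 ≤ N) (T : ℝ) (hT : 0 < T)
    (Ω : Set (HeatLarge.Space N)) (hΩo : IsOpen Ω) (hΩb : Bornology.IsBounded Ω)
    (u₀ : HeatLarge.Space N → ℝ) (hu₀ : LocallyIntegrableOn u₀ Ω)
    (hu₀nn : ∀ᵐ x ∂(volume.restrict Ω), 0 ≤ u₀ x)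
    (u : ℕ → ℝ × HeatLarge.Space N → ℝ)
    (hu : ∀ n : ℕ, HeatLarge.IsWeakSolution T Ω (n : ℝ)
      (fun x => HeatLarge.trunc (n : ℝ) (u₀ x)) (u n)) :
    ∃ v : ℕ → ℝ × HeatLarge.Space N → ℝ,
      (∀ n, ContinuousOn (v n) (HeatLarge.cylinder T Ω) ∧
        v n =ᵐ[volume.restrict (HeatLarge.cylinder T Ω)] u n) ∧
      ∀ z ∈ HeatLarge.cylinder T Ω, Tendsto (fun n => v n z) atTop atTop := by
  choose v hvc hvu using fun n => (hu n).exists_continuousOn_ae_eq hΩo hΩb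
  refine ⟨v, fun n => ⟨hvc n, hvu n⟩, fun z hz => ?_⟩
  let i₀ : Fin N := ⟨0, hN⟩
  obtain ⟨A, hA⟩ := hΩb.exists_norm_le
  have hA' : ∀ x ∈ Ω, x i₀ ≤ A := fun x hx =>
    (le_abs_self _).trans ((PiLp.norm_apply_le x i₀).trans (hA x hx))
  -- The parameter `κ` is fixed by the point `z` alone, so the lower bound below grows linearly in
  -- `n` with a positive slope independent of `n`.
  obtain ⟨κ, hκ, hpos⟩ := HeatLarge.exists_barrier_pos T A i₀ hz.1.1 z.2
  have hlow : ∀ n : ℕ, (n : ℝ) * HeatLarge.barrier T A κ i₀ z.1 z.2 ≤ v n z := fun n => by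
    refine (hu n).mul_barrier_le hΩo hΩb hT (Nat.cast_nonneg n) ?_ (hvc n) (hvu n) hκ hA' hz
    filter_upwards [hu₀nn] with x hx
    exact le_max_of_le_left (le_min (Nat.cast_nonneg n) hx)
  exact tendsto_atTop_mono hlow (tendsto_natCast_atTop_atTop.atTop_mul_const hpos)
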